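/- **Theorem (Agreement of Mahi-Mahi with wave length 5).** Let $f\ge 0$, $n=3f+1$ and $1\le \ell\le n$. Consider $n$ validators running the Mahi-Mahi protocol with wave length $5$ and $\ell$ leader slots per round, in an asynchronous message-passing network, against an adversary that schedules all steps and may adaptively corrupt up to $f$ validators. A validator is *honest* if it is never corrupted. Then, with probability $1$ over the common coin: in every run in which every message between honest validators is eventually received and every honest validator that is able to create its next block eventually does so, if some honest validator delivers a block $b$, then every honest validator eventually delivers $b$. The notions used are the following. *Blocks.* A block has an author, a round number, a list of transactions and an ordered list of (hash) references to blocks. It is *valid* if it references distinct valid blocks of smaller rounds and, unless it is of the first round, among them blocks of the previous round by at least $2f+1$ validators. The *causal history* of a block consists of the block and of all blocks reachable from it along references. Hashes and signatures are ideal. *Protocol.* An honest validator creates one block per round, round after round; the references of the block are to blocks of its local DAG, start with its own most recent block, and satisfy the conditions of validity. It sends the block to all validators. On receiving a valid block it stores it and requests from the sender those referenced blocks that are not in its local DAG; it answers a request for a block of its local DAG by sending this block. Its *local DAG* consists of the blocks whose whole causal history it has stored. Corrupted validators may send anything they can sign, including several blocks for one round. *Coin.* For each round $r$ the coin selects an ordered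 tuple of $\ell$ distinct validators, the leaders of the slots $(r,0),\dots,(r,\ell-1)$. The tuples of different rounds are independent and identically distributed, and each slot's leader is uniform over the $n$ validators. The adversary knows all past steps, and the leaders of round $r$ once coin shares of $2f+1$ validators for them are known to it; an uncorrupted validator's share becomes known with its block of round $r+4$. *Decision rule.* Slots are ordered by round and then by position. The blocks of a slot $(r,i)$ in a local DAG are the blocks of round $r$ by the leader of the slot. A block of round $r+3$ *votes* for the first block of round $r$ by a given author that a depth-first search along the references meets. A block of round $r+4$ is a *certificate* for a block $b$ of round $r$ if it references votes for $b$ of round $r+3$ by at least $2f+1$ validators. A validator classifies the slots of round $r$ only once its local DAG has blocks of round $r+4$ by at least $2f+1$ validators. - *Direct rule:* a slot is committed with its block $b$ if the local DAG contains certificates for $b$ by at least $2f+1$ validators; it is skipped if the local DAG contains blocks of round $r+3$ by at least $2f+1$ validators and, for every block $b$ of the slot, blocks of round $r+3$ that do not vote for $b$ by at least $2f+1$ validators. - *Indirect rule:* for a slot that the direct rule leaves undecided, the anchor is the first slot of a round greater than $r+4$ that is not classified as skip. If the anchor is committed with a block $a$, the slot is committed with a block $b$ of the slot for which the causal history of $a$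 contains a certificate, and it is skipped if there is no such $b$. If the anchor is undecided or does not exist, the slot remains undecided. *Delivery.* A validator delivers $b$ at a slot $s$ when, in its local DAG, $s$ is committed with a leader block $l$ whose causal history contains $b$, all slots up to $s$ are decided, and $b$ is not in the causal history of the leader block committed in any lower slot. -/

import Mathlib

open MeasureTheory

universe u

namespace MahiMahi

/-! ### Validators, blocks, causal history, validity -/

/-- The committee has `n = 3f + 1` validators. -/
abbrev Validator (f : ℕ) := Fin (3 * f + 1)

/-- A set of validators of size at least `2f + 1`. -/
def Quorum {f : ℕ} (S : Set (Validator f)) : Prop := 2 * f + 1 ≤ S.ncard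

/-- A signed block: author, round number, list of transactions, and the ordered sequence of hash
references to earlier blocks. Hashes are ideal (collision free), so that a reference is represented
by the block it points to. The signature is represented by the rule `State.Authentic` below on who
can bring a block into existence. The coin share carried by a block is determined by its author and
its round. Rounds are numbered from `0`; blocks of round `0` have no references. -/
inductive Block (f : ℕ) (Tx : Type u) : Type u
  | mk (author : Validator f) (round : ℕ) (txs : List Tx) (parents : List (Block f Tx)) : Block f Tx

namespace Block

variable {f : ℕ} {Tx : Type u}

def author : Block f Tx → Validator f
  | mk a _ _ _ => a

def round : Block f Tx → ℕ
  | mk _ r _ _ => r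

def parents : Block f Tx → List (Block f Tx)
  | mk _ _ _ ps => ps

end Block

/-- `IsLink a b`: there is a path of references from `b` down to `a` (possibly of length zero), that
is, `a` belongs to the causal history of `b`, which contains `b` itself. -/
def IsLink {f : ℕ} {Tx : Type u} (a b : Block f Tx) : Prop :=
  Relation.ReflTransGen (fun x y : Block f Tx => x ∈ y.parents) a b

/-- The conditions on the references of a single block: they are distinct, point to earlier rounds,
and, except in the first round, include blocks of the previous round by `2f + 1` validators. -/
def WellFormed {f : ℕ} {Tx : Type u} (b : Block f Tx) : Prop :=
  b.parents.Nodup ∧ (∀ p ∈ b.parents, p.round < b.round) ∧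
    (0 < b.round → Quorum {v | ∃ p ∈ b.parents, p.author = v ∧ p.round + 1 = b.round})

/-- A valid block is well formed and references only valid blocks. -/
def Valid {f : ℕ} {Tx : Type u} (b : Block f Tx) : Prop :=
  ∀ a, IsLink a b → WellFormed a

/-! ### Votes and certificates -/

mutual

/-- Depth-first search, from `b` along the references, for the first block by `id` of round `r`. -/
def votedBlock {f : ℕ} {Tx : Type u} (id : Validator f) (r : ℕ) : Block f Tx → Option (Block f Tx)
  | .mk _ rb _ ps => if rb ≤ r then none else votedIn id r ps

/-- The loop of the depth-first search over a list of references. -/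
def votedIn {f : ℕ} {Tx : Type u} (id : Validator f) (r : ℕ) :
    List (Block f Tx) → Option (Block f Tx)
  | [] => none
  | b :: bs =>
    if b.author = id ∧ b.round = r then some b
    else
      match votedBlock id r b with
      | some x => some x
      | none => votedIn id r bs

end

/-- `bVote` is a vote for `bLeader`. -/
def IsVote {f : ℕ} {Tx : Type u} (bVote bLeader : Block f Tx) : Prop :=
  votedBlock bLeader.author bLeader.round bVote = some bLeader

/-- The Certify round of the wave of length `w` whose Propose round is `r`. -/
def certifyRound (w r : ℕ) : ℕ := r + w - 1

/-- The Vote round of the wave of length `w` whose Propose round is `r`. -/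
def voteRound (w r : ℕ) : ℕ := certifyRound w r - 1

/-- `bCert` references Vote-round blocks by `2f + 1` validators that are votes for `bLeader`. -/
def IsCert {f : ℕ} {Tx : Type u} (w : ℕ) (bCert bLeader : Block f Tx) : Prop :=
  Quorum {v | ∃ b ∈ bCert.parents,
    b.author = v ∧ b.round = voteRound w bLeader.round ∧ IsVote b bLeader}

/-! ### Leader slots and the decision rule -/

/-- The leaders that the coin selects for one round: `ℓ` distinct validators, in order. -/
abbrev Leaders (f ℓ : ℕ) := Fin ℓ ↪ Validator f

instance instMeasurableSpaceLeaders (f ℓ : ℕ) : MeasurableSpace (Leaders f ℓ) := ⊤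

/-- A leader slot: a round and the position of the slot within the round. -/
abbrev Slot (ℓ : ℕ) := ℕ × Fin ℓ

/-- The order of the leader slots: by round, then by position within the round. -/
def Slot.Before {ℓ : ℕ} (s s' : Slot ℓ) : Prop := s.1 < s'.1 ∨ (s.1 = s'.1 ∧ s.2 < s'.2)

section Decision

variable {f ℓ : ℕ} {Tx : Type u}

/-- The local DAG `D` contains coin shares of `2f + 1` validators from the Certify round belonging
to round `r`, so that the leader slots of round `r` can be determined from it. -/
def CoinReady (w : ℕ) (D : Set (Block f Tx)) (r : ℕ) : Prop :=
  Quorum {v | ∃ b ∈ D, b.author = v ∧ b.round = certifyRound w r}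

/-- The blocks of the local DAG `D` in slot `s` (several in case of equivocation). -/
def slotBlocks (c : ℕ → Leaders f ℓ) (D : Set (Block f Tx)) (s : Slot ℓ) : Set (Block f Tx) :=
  {b | b ∈ D ∧ b.author = c s.1 s.2 ∧ b.round = s.1}

/-- Vote-round blocks by `2f + 1` validators in `D` are not votes for `bLeader`. -/
def SkippedLeader (w : ℕ) (D : Set (Block f Tx)) (bLeader : Block f Tx) : Prop :=
  Quorum {v | ∃ b ∈ D, b.author = v ∧ b.round = voteRound w bLeader.round ∧ ¬ IsVote b bLeader}

/-- Certify-round blocks by `2f + 1` validators in `D` are certificates for `bLeader`. -/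
def SupportedLeader (w : ℕ) (D : Set (Block f Tx)) (bLeader : Block f Tx) : Prop :=
  Quorum {v | ∃ b ∈ D,
    b.author = v ∧ b.round = certifyRound w bLeader.round ∧ IsCert w b bLeader}

/-- Direct decision rule, commit case. -/
def DirectCommit (w : ℕ) (c : ℕ → Leaders f ℓ) (D : Set (Block f Tx)) (s : Slot ℓ)
    (b : Block f Tx) : Prop :=
  CoinReady w D s.1 ∧ b ∈ slotBlocks c D s ∧ SupportedLeader w D b

/-- Direct decision rule, skip case: Vote-round blocks by `2f + 1` validators are present, and every
block of the slot is skipped. The first condition only matters for a slot without any block. -/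
def DirectSkip (w : ℕ) (c : ℕ → Leaders f ℓ) (D : Set (Block f Tx)) (s : Slot ℓ) : Prop :=
  CoinReady w D s.1 ∧
    Quorum {v | ∃ b ∈ D, b.author = v ∧ b.round = voteRound w s.1} ∧
    ∀ b ∈ slotBlocks c D s, SkippedLeader w D b

/-- The direct decision rule leaves slot `s` undecided. -/
def DirectUndecided (w : ℕ) (c : ℕ → Leaders f ℓ) (D : Set (Block f Tx)) (s : Slot ℓ) : Prop :=
  ¬ DirectSkip w c D s ∧ ∀ b, ¬ DirectCommit w c D s b

/-- The causal history of `bAnchor` contains a certificate for `bLeader`. -/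
def IsCertifiedLink (w : ℕ) (D : Set (Block f Tx)) (bAnchor bLeader : Block f Tx) : Prop :=
  ∃ b ∈ D, b.round = certifyRound w bLeader.round ∧ IsCert w b bLeader ∧ IsLink b bAnchor

/-- The classification of the slots by a validator with local DAG `D`: `Status w c D s (some b)`
says that `s` is classified as `commit(b)`, `Status w c D s none` that it is classified as `skip`;
a slot with neither is `undecided`. The anchor of `s` is the first slot after the Certify round of
`s` that is not classified as `skip`; the indirect rule applies when it is committed. -/
inductive Status (w : ℕ) (c : ℕ → Leaders f ℓ) (D : Set (Block f Tx)) :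
    Slot ℓ → Option (Block f Tx) → Prop
  | directCommit (s : Slot ℓ) (b : Block f Tx) (h : DirectCommit w c D s b) :
      Status w c D s (some b)
  | directSkip (s : Slot ℓ) (h : DirectSkip w c D s) :
      Status w c D s none
  | indirectCommit (s anchor : Slot ℓ) (a b : Block f Tx)
      (hu : DirectUndecided w c D s)
      (hr : certifyRound w s.1 < anchor.1)
      (hskip : ∀ s' : Slot ℓ, certifyRound w s.1 < s'.1 → s'.Before anchor → Status w c D s' none)
      (ha : Status w c D anchor (some a))
      (hcoin : CoinReady w D s.1)
      (hb : b ∈ slotBlocks c D s) (hl : IsCertifiedLink w D a b) :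
      Status w c D s (some b)
  | indirectSkip (s anchor : Slot ℓ) (a : Block f Tx)
      (hu : DirectUndecided w c D s)
      (hr : certifyRound w s.1 < anchor.1)
      (hskip : ∀ s' : Slot ℓ, certifyRound w s.1 < s'.1 → s'.Before anchor → Status w c D s' none)
      (ha : Status w c D anchor (some a))
      (hcoin : CoinReady w D s.1)
      (hl : ∀ b ∈ slotBlocks c D s, ¬ IsCertifiedLink w D a b) :
      Status w c D s none

/-- A validator with local DAG `D` has delivered `b` at slot `s`: a leader block `l` whose causal
history contains `b` is committed in `s`, all slots up to `s` are decided, and `b` is not delivered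
with the leader block of a lower slot. -/
def DeliveredAt (w : ℕ) (c : ℕ → Leaders f ℓ) (D : Set (Block f Tx)) (s : Slot ℓ)
    (b : Block f Tx) : Prop :=
  (∃ l, Status w c D s (some l) ∧ IsLink b l) ∧
    (∀ s' : Slot ℓ, s'.Before s → ∃ o, Status w c D s' o) ∧
    ∀ s' : Slot ℓ, s'.Before s → ∀ l', Status w c D s' (some l') → ¬ IsLink b l'

end Decision

/-! ### Executions under an adaptive adversary in an asynchronous network -/

/-- Messages: a block, or the request (by hash) of a block. -/
inductive Msg (f : ℕ) (Tx : Type u) : Type u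
  | block (b : Block f Tx) : Msg f Tx
  | request (b : Block f Tx) : Msg f Tx

/-- The steps that the adversary can schedule: corrupt a validator; let an honest validator create
and broadcast its next block; let a corrupted validator send a message; let a validator `dst`
receive and process a message that `src` has sent to it. -/
inductive Event (f : ℕ) (Tx : Type u) : Type u
  | corrupt (v : Validator f) : Event f Tx
  | propose (v : Validator f) (txs : List Tx) (parents : List (Block f Tx)) : Event f Tx
  | byzSend (src dst : Validator f) (m : Msg f Tx) : Event f Tx
  | receive (src dst : Validator f) (m : Msg f Tx) : Event f Tx

/-- A global state: the validators corrupted so far, the blocks created by validators while honest,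
the last such block of each validator, the valid blocks each validator has downloaded, and the
messages sent so far (sender, receiver, message). -/
structure State (f : ℕ) (Tx : Type u) where
  corrupted : Finset (Validator f)
  signed : Set (Block f Tx)
  last : Validator f → Option (Block f Tx)
  store : Validator f → Set (Block f Tx)
  sent : Set (Validator f × Validator f × Msg f Tx)

namespace State

variable {f : ℕ} {Tx : Type u}

/-- The initial state: nobody is corrupted, there are no blocks and no messages. -/
def init (f : ℕ) (Tx : Type u) : State f Tx :=
  ⟨∅, ∅, fun _ => none, fun _ => ∅, ∅⟩

/-- The local DAG of `v`: the blocks whose entire causal history `v` has downloaded. -/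
def dag (S : State f Tx) (v : Validator f) : Set (Block f Tx) :=
  {b | ∀ a, IsLink a b → a ∈ S.store v}

/-- The round of the next block of `v`. -/
def nextRound (S : State f Tx) (v : Validator f) : ℕ :=
  (S.last v).elim 0 fun b => b.round + 1

/-- Honest `v` may create its next block with the given content: one block in each round, references
into its local DAG that start with its own most recent block, and the conditions of validity. -/
def MayPropose (S : State f Tx) (v : Validator f) (txs : List Tx)
    (parents : List (Block f Tx)) : Prop :=
  v ∉ S.corrupted ∧ parents.head? = S.last v ∧ (∀ p ∈ parents, p ∈ S.dag v) ∧
    WellFormed (Block.mk v (S.nextRound v) txs parents)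

/-- All signatures in the causal history of `b` are available to the adversary: a block by a
validator that is not corrupted exists only if that validator has created it. -/
def Authentic (S : State f Tx) (b : Block f Tx) : Prop :=
  ∀ a, IsLink a b → a.author ∈ S.corrupted ∨ a ∈ S.signed

/-- A corrupted validator may send any request and any authentic block. -/
def MaySend (S : State f Tx) : Msg f Tx → Prop
  | .block b => S.Authentic b
  | .request _ => True

/-- Processing of a message from `src` by an honest validator `dst`. A valid block is stored, and
those of its references that are not yet in the local DAG are requested from `src`; invalid blocks
are discarded. A requested block is sent to `src` if it is in the local DAG. -/
noncomputable def process (S : State f Tx) (src dst : Validator f) : Msg f Tx → State f Tx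
  | .block b =>
    open Classical in
    if Valid b then
      { S with
        store := Function.update S.store dst (insert b (S.store dst))
        sent := S.sent ∪ {x | ∃ p ∈ b.parents, p ∉ S.dag dst ∧ x = (dst, src, Msg.request p)} }
    else S
  | .request b =>
    open Classical in
    if b ∈ S.dag dst then { S with sent := insert (dst, src, Msg.block b) S.sent } else S

/-- One step of the system. A step that is not possible in the current state has no effect. -/
noncomputable def step (S : State f Tx) : Event f Tx → State f Tx
  | .corrupt v =>
    if (insert v S.corrupted).card ≤ f then { S with corrupted := insert v S.corrupted } else S
  | .propose v txs parents =>
    open Classical in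
    if S.MayPropose v txs parents then
      let b := Block.mk v (S.nextRound v) txs parents
      { S with
        signed := insert b S.signed
        last := Function.update S.last v (some b)
        store := Function.update S.store v (insert b (S.store v))
        sent := S.sent ∪ {x | ∃ dst, x = (v, dst, Msg.block b)} }
    else S
  | .byzSend src dst m =>
    open Classical in
    if src ∈ S.corrupted ∧ S.MaySend m then { S with sent := insert (src, dst, m) S.sent } else S
  | .receive src dst m =>
    open Classical in
    if (src, dst, m) ∈ S.sent ∧ dst ∉ S.corrupted then S.process src dst m else S

/-- The coin that elects the leaders of round `r` is open: shares of `2f + 1` validators are known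
to the adversary. The share of a validator that is not corrupted becomes known with its block of the
Certify round. -/
def CoinOpen (w : ℕ) (S : State f Tx) (r : ℕ) : Prop :=
  Quorum {v | v ∈ S.corrupted ∨ ∃ b ∈ S.signed, b.author = v ∧ b.round = certifyRound w r}

/-- The coins that the adversary can see. -/
noncomputable def visibleCoins {ℓ : ℕ} (w : ℕ) (S : State f Tx) (c : ℕ → Leaders f ℓ) (r : ℕ) :
    Option (Leaders f ℓ) :=
  open Classical in if S.CoinOpen w r then some (c r) else none

end State

/-- An adversary chooses each step from all the past steps and from the coins opened so far. -/
def Adversary (f ℓ : ℕ) (Tx : Type u) : Type u :=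
  List (Event f Tx) → (ℕ → Option (Leaders f ℓ)) → Event f Tx

section Execution

variable {f ℓ : ℕ} {Tx : Type u}

/-- The past steps and the state at time `t` in the run of the adversary `adv` when the coin of each
round `r` is `c r`. -/
noncomputable def run (w : ℕ) (adv : Adversary f ℓ Tx) (c : ℕ → Leaders f ℓ) :
    ℕ → List (Event f Tx) × State f Tx
  | 0 => ([], State.init f Tx)
  | t + 1 =>
    let x := run w adv c t
    let e := adv x.1 (x.2.visibleCoins w c)
    (x.1 ++ [e], x.2.step e)

/-- The state at time `t`. -/
noncomputable def stateAt (w : ℕ) (adv : Adversary f ℓ Tx) (c : ℕ → Leaders f ℓ) (t : ℕ) :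
    State f Tx :=
  (run w adv c t).2

/-- The step taken at time `t`. -/
noncomputable def eventAt (w : ℕ) (adv : Adversary f ℓ Tx) (c : ℕ → Leaders f ℓ) (t : ℕ) :
    Event f Tx :=
  adv (run w adv c t).1 ((run w adv c t).2.visibleCoins w c)

/-- `v` is honest in the run: it is never corrupted. -/
def Honest (w : ℕ) (adv : Adversary f ℓ Tx) (c : ℕ → Leaders f ℓ) (v : Validator f) : Prop :=
  ∀ t, v ∉ (stateAt w adv c t).corrupted

/-- Messages among honest validators are eventually received. -/
def ReliableLinks (w : ℕ) (adv : Adversary f ℓ Tx) (c : ℕ → Leaders f ℓ) : Prop :=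
  ∀ src dst, Honest w adv c src → Honest w adv c dst → ∀ m t,
    (src, dst, m) ∈ (stateAt w adv c t).sent →
      ∃ t', (src, dst, m) ∈ (stateAt w adv c t').sent ∧ eventAt w adv c t' = .receive src dst m

/-- An honest validator that is able to create its next block eventually does so. -/
def HonestProgress (w : ℕ) (adv : Adversary f ℓ Tx) (c : ℕ → Leaders f ℓ) : Prop :=
  ∀ v, Honest w adv c v → ∀ t,
    (∃ txs parents, (stateAt w adv c t).MayPropose v txs parents) →
      ∃ t', (stateAt w adv c t).nextRound v < (stateAt w adv c t').nextRound v

/-- `v` delivers the block `b` at some time of the run. -/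
def Delivers (w : ℕ) (adv : Adversary f ℓ Tx) (c : ℕ → Leaders f ℓ) (v : Validator f)
    (b : Block f Tx) : Prop :=
  ∃ (t : ℕ) (s : Slot ℓ), DeliveredAt w c ((stateAt w adv c t).dag v) s b

end Execution

/-- The law of the leaders of one round is that of a fair coin: the leader of every slot is uniformly
distributed over the validators. -/
def FairCoin {f ℓ : ℕ} (ν : Measure (Leaders f ℓ)) : Prop :=
  ∀ (i : Fin ℓ) (v : Validator f), ν {L | L i = v} = ((3 * f + 1 : ℕ) : ENNReal)⁻¹

end MahiMahi

namespace MahiMahi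

/-! ### Causal histories and votes -/

section Blocks

variable {f : ℕ} {Tx : Type u}

theorem isLink_iff {a b : Block f Tx} : IsLink a b ↔ a = b ∨ ∃ p ∈ b.parents, IsLink a p := by
  unfold IsLink
  rw [Relation.ReflTransGen.cases_tail_iff]
  constructor
  · rintro (h | ⟨c, h, hc⟩)
    · exact Or.inl h.symm
    · exact Or.inr ⟨c, hc, h⟩
  · rintro (h | ⟨c, hc, h⟩)
    · exact Or.inl h.symm
    · exact Or.inr ⟨c, h, hc⟩

theorem IsLink.refl (a : Block f Tx) : IsLink a a := Relation.ReflTransGen.refl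

theorem IsLink.trans {a b c : Block f Tx} (h : IsLink a b) (h' : IsLink b c) : IsLink a c :=
  Relation.ReflTransGen.trans h h'

theorem IsLink.of_parent {p b : Block f Tx} (h : p ∈ b.parents) : IsLink p b :=
  Relation.ReflTransGen.single h

theorem Valid.wellFormed {b : Block f Tx} (h : Valid b) : WellFormed b := h b (.refl b)

theorem Valid.of_isLink {a b : Block f Tx} (h : Valid b) (hab : IsLink a b) : Valid a :=
  fun _ hc => h _ (hc.trans hab)

theorem Valid.of_parents {b : Block f Tx} (h : WellFormed b) (hp : ∀ p ∈ b.parents, Valid p) :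
    Valid b := by
  intro a ha
  obtain rfl | ⟨p, hpb, hap⟩ := isLink_iff.1 ha
  · exact h
  · exact hp p hpb a hap

theorem Valid.round_lt {a b : Block f Tx} (h : Valid b) (hab : IsLink a b) :
    a = b ∨ a.round < b.round := by
  unfold IsLink at hab
  induction hab with
  | refl => exact Or.inl rfl
  | @tail c d hac hcd ih =>
    have h1 : c.round < d.round := h.wellFormed.2.1 c hcd
    rcases ih (h.of_isLink (.of_parent hcd)) with rfl | h2
    · exact Or.inr h1
    · exact Or.inr (h2.trans h1)

mutual

theorem votedBlock_eq_some {id : Validator f} {r : ℕ} :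
    ∀ {b x : Block f Tx}, votedBlock id r b = some x →
      IsLink x b ∧ x.author = id ∧ x.round = r
  | .mk a rb txs ps, x, h => by
    rw [votedBlock] at h
    split_ifs at h
    obtain ⟨p, hp, hx, h'⟩ := votedIn_eq_some h
    exact ⟨isLink_iff.2 (Or.inr ⟨p, hp, hx⟩), h'⟩

theorem votedIn_eq_some {id : Validator f} {r : ℕ} :
    ∀ {bs : List (Block f Tx)} {x : Block f Tx}, votedIn id r bs = some x →
      ∃ b ∈ bs, IsLink x b ∧ x.author = id ∧ x.round = r
  | [], x, h => by simp [votedIn] at h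
  | b :: bs, x, h => by
    rw [votedIn] at h
    split_ifs at h with hb
    · cases h
      exact ⟨b, by simp, .refl b, hb⟩
    · split at h
      · rename_i y hy
        cases h
        exact ⟨b, by simp, votedBlock_eq_some hy⟩
      · obtain ⟨c, hc, h'⟩ := votedIn_eq_some h
        exact ⟨c, by simp [hc], h'⟩

end

mutual

theorem votedBlock_eq_none {id : Validator f} {r : ℕ} :
    ∀ {b : Block f Tx}, votedBlock id r b = none → Valid b →
      ∀ x, IsLink x b → x ≠ b → x.author = id → x.round ≠ r
  | .mk a rb txs ps, h, hv, x, hx, hne, hid => by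
    rw [votedBlock] at h
    split_ifs at h with hr
    · have := (hv.round_lt hx).resolve_left hne
      simp only [Block.round] at this
      exact (this.trans_le hr).ne
    · obtain ⟨p, hp, hxp⟩ := (isLink_iff.1 hx).resolve_left hne
      exact votedIn_eq_none h p hp (hv.of_isLink (.of_parent hp)) x hxp hid

theorem votedIn_eq_none {id : Validator f} {r : ℕ} :
    ∀ {bs : List (Block f Tx)}, votedIn id r bs = none → ∀ b ∈ bs, Valid b →
      ∀ x, IsLink x b → x.author = id → x.round ≠ r
  | [], _, b, hb, _, _, _, _ => by simp at hb
  | c :: bs, h, b, hb, hv, x, hx, hid => by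
    rw [votedIn] at h
    split_ifs at h with hc
    split at h
    · simp at h
    · rename_i hcn
      rcases List.mem_cons.1 hb with hbc | hb
      · rw [hbc] at hv hx
        by_cases hxc : x = c
        · subst hxc
          exact fun hr => hc ⟨hid, hr⟩
        · exact votedBlock_eq_none hcn hv x hx hxc hid
      · exact votedIn_eq_none h b hb hv x hx hid

end

theorem IsVote.isLink {x b : Block f Tx} (h : IsVote x b) : IsLink b x :=
  (votedBlock_eq_some h).1

theorem IsVote.eq_of_same_slot {x b b' : Block f Tx} (h : IsVote x b) (h' : IsVote x b')
    (ha : b.author = b'.author) (hr : b.round = b'.round) : b = b' := by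
  unfold IsVote at h h'
  rw [ha, hr, h'] at h
  exact (Option.some.inj h).symm

theorem isVote_of_unique {x b : Block f Tx} (hv : Valid x) (hb : IsLink b x) (hne : b ≠ x)
    (hu : ∀ y, IsLink y x → y.author = b.author → y.round = b.round → y = b) : IsVote x b := by
  unfold IsVote
  cases h : votedBlock b.author b.round x with
  | none => exact absurd rfl (votedBlock_eq_none h hv b hb hne rfl)
  | some y =>
    obtain ⟨h1, h2, h3⟩ := votedBlock_eq_some h
    rw [hu y h1 h2 h3]

end Blocks

/-! ### Quorums -/

section Quorums

variable {f : ℕ}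

theorem Quorum.mono {P Q : Set (Validator f)} (h : Quorum P) (hPQ : P ⊆ Q) : Quorum Q :=
  le_trans h (Set.ncard_le_ncard hPQ (Set.toFinite _))

theorem Quorum.exists_mem_inter {P Q : Set (Validator f)} (hP : Quorum P) (hQ : Quorum Q)
    {C : Finset (Validator f)} (hC : C.card ≤ f) : ∃ v ∈ P, v ∈ Q ∧ v ∉ C := by
  by_contra! h
  have h1 : (P ∩ Q).ncard ≤ C.card := by
    rw [← Set.ncard_coe_finset]
    exact Set.ncard_le_ncard (fun v hv => h v hv.1 hv.2) (Set.toFinite _)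
  have h2 := Set.ncard_union_add_ncard_inter P Q (Set.toFinite _) (Set.toFinite _)
  have h3 : (P ∪ Q).ncard ≤ 3 * f + 1 := by
    simpa using Set.ncard_le_ncard (Set.subset_univ (P ∪ Q)) (Set.toFinite _)
  unfold Quorum at hP hQ
  omega

theorem Quorum.exists_notMem {P : Set (Validator f)} (hP : Quorum P)
    {C : Finset (Validator f)} (hC : C.card ≤ f) : ∃ v ∈ P, v ∉ C := by
  obtain ⟨v, hv, _, h⟩ := hP.exists_mem_inter hP hC
  exact ⟨v, hv, h⟩

theorem quorum_compl {C : Finset (Validator f)} (hC : C.card ≤ f) :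
    Quorum {v : Validator f | v ∉ C} := by
  have h : {v : Validator f | v ∉ C} = ((Cᶜ : Finset (Validator f)) : Set (Validator f)) := by
    ext; simp
  unfold Quorum
  rw [h, Set.ncard_coe_finset, Finset.card_compl, Fintype.card_fin]
  omega

/-- If each validator in `W` outside `C` is related to all but at most `f` validators outside `C`,
then some validator outside `C` is related to all but few of `W`. -/
theorem exists_popular {C W : Finset (Validator f)} (hC : C.card ≤ f) (hW : Disjoint W C)
    (R : Validator f → Validator f → Prop) [∀ w v, Decidable (R w v)]
    (hR : ∀ w ∈ W, (Cᶜ.filter fun v => ¬ R w v).card ≤ f) :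
    ∃ v ∉ C, (W.filter fun w => ¬ R w v).card + C.card ≤ 2 * f := by
  by_contra! h
  have hN : (Cᶜ : Finset (Validator f)).card = 3 * f + 1 - C.card := by
    rw [Finset.card_compl, Fintype.card_fin]
  have h1 : (Cᶜ : Finset (Validator f)).card * (f + 1)
      ≤ ∑ v ∈ Cᶜ, (W.filter fun w => ¬ R w v).card := by
    rw [← smul_eq_mul]
    refine Finset.card_nsmul_le_sum _ _ _ fun v hv => ?_
    have := h v (by simpa using hv)
    omega
  have h2 : ∑ v ∈ Cᶜ, (W.filter fun w => ¬ R w v).card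
      = ∑ w ∈ W, (Cᶜ.filter fun v => ¬ R w v).card := by
    simp only [Finset.card_filter]
    exact Finset.sum_comm
  have h3 : ∑ w ∈ W, (Cᶜ.filter fun v => ¬ R w v).card ≤ W.card * f :=
    Finset.sum_le_card_nsmul _ _ _ hR
  have h4 : W.card ≤ (Cᶜ : Finset (Validator f)).card :=
    Finset.card_le_card (Finset.subset_compl_iff_disjoint_right.2 hW)
  have h5 := Nat.mul_le_mul_right f h4
  have h6 : 0 < (Cᶜ : Finset (Validator f)).card := by omega
  nlinarith

end Quorums

end MahiMahi

namespace MahiMahi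

/-! ### Invariants of reachable states -/

namespace State

variable {f : ℕ} {Tx : Type u}

/-- The order in which states grow along a run. -/
structure Le (S S' : State f Tx) : Prop where
  corrupted : S.corrupted ⊆ S'.corrupted
  signed : S.signed ⊆ S'.signed
  store : ∀ v, S.store v ⊆ S'.store v
  sent : S.sent ⊆ S'.sent
  nextRound : ∀ v, S.nextRound v ≤ S'.nextRound v

theorem Le.refl (S : State f Tx) : S.Le S :=
  ⟨subset_rfl, subset_rfl, fun _ => subset_rfl, subset_rfl, fun _ => le_rfl⟩

theorem Le.trans {S S' S'' : State f Tx} (h : S.Le S') (h' : S'.Le S'') : S.Le S'' :=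
  ⟨h.corrupted.trans h'.corrupted, h.signed.trans h'.signed,
    fun v => (h.store v).trans (h'.store v), h.sent.trans h'.sent,
    fun v => (h.nextRound v).trans (h'.nextRound v)⟩

theorem Le.dag {S S' : State f Tx} (h : S.Le S') (v : Validator f) : S.dag v ⊆ S'.dag v :=
  fun _ hb a ha => h.store v (hb a ha)

theorem Le.authentic {S S' : State f Tx} (h : S.Le S') {b : Block f Tx} (hb : S.Authentic b) :
    S'.Authentic b :=
  fun a ha => (hb a ha).imp (fun x => h.corrupted x) (fun x => h.signed x)

theorem mem_dag_of_isLink {S : State f Tx} {v : Validator f} {a b : Block f Tx}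
    (hb : b ∈ S.dag v) (hab : IsLink a b) : a ∈ S.dag v :=
  fun _ hc => hb _ (hc.trans hab)

theorem mem_store_of_mem_dag {S : State f Tx} {v : Validator f} {b : Block f Tx}
    (hb : b ∈ S.dag v) : b ∈ S.store v := hb b (.refl b)

theorem mem_dag_of_parents {S : State f Tx} {v : Validator f} {b : Block f Tx}
    (hb : b ∈ S.store v) (hp : ∀ p ∈ b.parents, p ∈ S.dag v) : b ∈ S.dag v := by
  intro a ha
  obtain rfl | ⟨p, hpb, hap⟩ := isLink_iff.1 ha
  · exact hb
  · exact hp p hpb a hap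

/-- The state after `v` has created the block `b`. -/
def afterPropose (S : State f Tx) (v : Validator f) (b : Block f Tx) : State f Tx :=
  { S with
    signed := insert b S.signed
    last := Function.update S.last v (some b)
    store := Function.update S.store v (insert b (S.store v))
    sent := S.sent ∪ {x | ∃ dst, x = (v, dst, Msg.block b)} }

/-- The state after `dst` has stored the block `b` received from `src`. -/
def afterStore (S : State f Tx) (src dst : Validator f) (b : Block f Tx) : State f Tx :=
  { S with
    store := Function.update S.store dst (insert b (S.store dst))
    sent := S.sent ∪ {x | ∃ p ∈ b.parents, p ∉ S.dag dst ∧ x = (dst, src, Msg.request p)} }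

/-- The state after the message `x` has been sent. -/
def afterSend (S : State f Tx) (x : Validator f × Validator f × Msg f Tx) : State f Tx :=
  { S with sent := insert x S.sent }

theorem subset_update_insert (S : State f Tx) (v u : Validator f) (b : Block f Tx) :
    S.store u ⊆ Function.update S.store v (insert b (S.store v)) u := by
  by_cases h : u = v
  · subst h
    simp
  · rw [Function.update_of_ne h]

theorem mem_update_insert {S : State f Tx} {v u : Validator f} {a b : Block f Tx}
    (h : a ∈ Function.update S.store v (insert b (S.store v)) u) :
    (u = v ∧ a = b) ∨ a ∈ S.store u := by
  by_cases hu : u = v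
  · subst hu
    rw [Function.update_self] at h
    exact h.imp (fun h => ⟨rfl, h⟩) id
  · rw [Function.update_of_ne hu] at h
    exact Or.inr h

theorem nextRound_afterPropose_self (S : State f Tx) (v : Validator f) (b : Block f Tx) :
    (S.afterPropose v b).nextRound v = b.round + 1 := by
  simp [afterPropose, nextRound]

theorem nextRound_afterPropose_of_ne (S : State f Tx) {v u : Validator f} (b : Block f Tx)
    (h : u ≠ v) : (S.afterPropose v b).nextRound u = S.nextRound u := by
  simp [afterPropose, nextRound, Function.update_of_ne h]

theorem le_afterPropose (S : State f Tx) (v : Validator f) {b : Block f Tx}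
    (hb : b.round = S.nextRound v) : S.Le (S.afterPropose v b) where
  corrupted := subset_rfl
  signed := Set.subset_insert _ _
  store := fun u => subset_update_insert S v u b
  sent := Set.subset_union_left
  nextRound := fun u => by
    by_cases h : u = v
    · subst h
      rw [nextRound_afterPropose_self, hb]
      exact Nat.le_succ _
    · rw [nextRound_afterPropose_of_ne S b h]

theorem le_afterStore (S : State f Tx) (src dst : Validator f) (b : Block f Tx) :
    S.Le (S.afterStore src dst b) :=
  ⟨subset_rfl, subset_rfl, fun u => subset_update_insert S dst u b, Set.subset_union_left,
    fun _ => le_rfl⟩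

theorem le_afterSend (S : State f Tx) (x : Validator f × Validator f × Msg f Tx) :
    S.Le (S.afterSend x) :=
  ⟨subset_rfl, subset_rfl, fun _ => subset_rfl, Set.subset_insert _ _, fun _ => le_rfl⟩

theorem le_corrupt (S : State f Tx) (v : Validator f) :
    S.Le { S with corrupted := insert v S.corrupted } :=
  ⟨Finset.subset_insert _ _, subset_rfl, fun _ => subset_rfl, subset_rfl, fun _ => le_rfl⟩

/-- The possible effects of a step. -/
theorem step_cases (S : State f Tx) (e : Event f Tx) (P : State f Tx → Prop) (h0 : P S)
    (hc : ∀ v, (insert v S.corrupted).card ≤ f →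
      P { S with corrupted := insert v S.corrupted })
    (hp : ∀ v txs parents, S.MayPropose v txs parents →
      P (S.afterPropose v (.mk v (S.nextRound v) txs parents)))
    (hb : ∀ src dst m, src ∈ S.corrupted → S.MaySend m → P (S.afterSend (src, dst, m)))
    (hs : ∀ src dst b, (src, dst, .block b) ∈ S.sent → dst ∉ S.corrupted → Valid b →
      P (S.afterStore src dst b))
    (hr : ∀ src dst b, (src, dst, .request b) ∈ S.sent → dst ∉ S.corrupted → b ∈ S.dag dst →
      P (S.afterSend (dst, src, .block b))) :
    P (S.step e) := by
  cases e with
  | corrupt v =>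
    simp only [step]
    split_ifs with h
    · exact hc v h
    · exact h0
  | propose v txs parents =>
    simp only [step]
    split_ifs with h
    · exact hp v txs parents h
    · exact h0
  | byzSend src dst m =>
    simp only [step]
    split_ifs with h
    · exact hb src dst m h.1 h.2
    · exact h0
  | receive src dst m =>
    simp only [step]
    split_ifs with h
    · cases m with
      | block b =>
        simp only [process]
        split_ifs with hv
        · exact hs src dst b h.1 h.2 hv
        · exact h0
      | request b =>
        simp only [process]
        split_ifs with hv
        · exact hr src dst b h.1 h.2 hv
        · exact h0
    · exact h0

theorem le_step (S : State f Tx) (e : Event f Tx) : S.Le (S.step e) :=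
  step_cases S e _ (.refl S) (fun v _ => le_corrupt S v)
    (fun v _ _ _ => le_afterPropose S v rfl) (fun _ _ _ _ _ => le_afterSend S _)
    (fun src dst b _ _ _ => le_afterStore S src dst b) (fun _ _ _ _ _ _ => le_afterSend S _)

/-- The invariants of the protocol. -/
structure Inv (S : State f Tx) : Prop where
  card_le : S.corrupted.card ≤ f
  signed_round : ∀ b ∈ S.signed, b.round < S.nextRound b.author
  exists_signed : ∀ v k, k < S.nextRound v → ∃ b ∈ S.signed, b.author = v ∧ b.round = k
  signed_unique : ∀ b ∈ S.signed, ∀ b' ∈ S.signed,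
    b.author = b'.author → b.round = b'.round → b = b'
  last_signed : ∀ v b, S.last v = some b → b ∈ S.signed ∧ b.author = v
  signed_dag : ∀ b ∈ S.signed, b ∈ S.dag b.author
  signed_sent : ∀ b ∈ S.signed, ∀ dst, (b.author, dst, Msg.block b) ∈ S.sent
  store_valid : ∀ v, ∀ b ∈ S.store v, Valid b
  store_authentic : ∀ v, ∀ b ∈ S.store v, S.Authentic b
  sent_authentic : ∀ src dst b, (src, dst, Msg.block b) ∈ S.sent → S.Authentic b
  sent_dag : ∀ src dst b, src ∉ S.corrupted → (src, dst, Msg.block b) ∈ S.sent → b ∈ S.dag src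
  request_dag : ∀ src dst b, src ∉ S.corrupted → dst ∉ S.corrupted →
    (src, dst, Msg.request b) ∈ S.sent → b ∈ S.dag dst

theorem inv_init : (State.init f Tx).Inv := by
  constructor <;> simp [State.init, nextRound]

theorem Inv.corrupt {S : State f Tx} (h : S.Inv) {v : Validator f}
    (hv : (insert v S.corrupted).card ≤ f) :
    Inv { S with corrupted := insert v S.corrupted } where
  card_le := hv
  signed_round := h.signed_round
  exists_signed := h.exists_signed
  signed_unique := h.signed_unique
  last_signed := h.last_signed
  signed_dag := h.signed_dag
  signed_sent := h.signed_sent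
  store_valid := h.store_valid
  store_authentic := fun v b hb => (le_corrupt S _).authentic (h.store_authentic v b hb)
  sent_authentic := fun src dst b hb => (le_corrupt S _).authentic (h.sent_authentic src dst b hb)
  sent_dag := fun src dst b hs => h.sent_dag src dst b fun hc => hs (Finset.mem_insert_of_mem hc)
  request_dag := fun src dst b hs hd => h.request_dag src dst b
    (fun hc => hs (Finset.mem_insert_of_mem hc)) (fun hc => hd (Finset.mem_insert_of_mem hc))

theorem Inv.afterSend {S : State f Tx} (h : S.Inv) {src dst : Validator f} {m : Msg f Tx}
    (ha : ∀ b, m = .block b → S.Authentic b)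
    (hd : ∀ b, src ∉ S.corrupted → m = .block b → b ∈ S.dag src)
    (hr : ∀ b, src ∉ S.corrupted → dst ∉ S.corrupted → m = .request b → b ∈ S.dag dst) :
    (S.afterSend (src, dst, m)).Inv where
  card_le := h.card_le
  signed_round := h.signed_round
  exists_signed := h.exists_signed
  signed_unique := h.signed_unique
  last_signed := h.last_signed
  signed_dag := h.signed_dag
  signed_sent := fun b hb dst => Or.inr (h.signed_sent b hb dst)
  store_valid := h.store_valid
  store_authentic := h.store_authentic
  sent_authentic := fun s d b hb => by
    rcases hb with hb | hb
    · simp only [Prod.mk.injEq] at hb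
      exact ha b hb.2.2.symm
    · exact h.sent_authentic s d b hb
  sent_dag := fun s d b hs hb => by
    rcases hb with hb | hb
    · simp only [Prod.mk.injEq] at hb
      obtain ⟨rfl, rfl, hb⟩ := hb
      exact hd b hs hb.symm
    · exact h.sent_dag s d b hs hb
  request_dag := fun s d b hs hd' hb => by
    rcases hb with hb | hb
    · simp only [Prod.mk.injEq] at hb
      obtain ⟨rfl, rfl, hb⟩ := hb
      exact hr b hs hd' hb.symm
    · exact h.request_dag s d b hs hd' hb

theorem Inv.afterStore {S : State f Tx} (h : S.Inv) {src dst : Validator f} {b : Block f Tx}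
    (hs : (src, dst, Msg.block b) ∈ S.sent) (hb : Valid b) : (S.afterStore src dst b).Inv where
  card_le := h.card_le
  signed_round := h.signed_round
  exists_signed := h.exists_signed
  signed_unique := h.signed_unique
  last_signed := h.last_signed
  signed_dag := fun a ha => (le_afterStore S src dst b).dag _ (h.signed_dag a ha)
  signed_sent := fun a ha d => Or.inl (h.signed_sent a ha d)
  store_valid := fun v a ha => by
    rcases mem_update_insert ha with ⟨_, rfl⟩ | ha
    · exact hb
    · exact h.store_valid v a ha
  store_authentic := fun v a ha => by
    rcases mem_update_insert ha with ⟨_, rfl⟩ | ha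
    · exact h.sent_authentic src dst a hs
    · exact h.store_authentic v a ha
  sent_authentic := fun s d a ha => by
    rcases ha with ha | ⟨p, _, _, ha⟩
    · exact h.sent_authentic s d a ha
    · simp at ha
  sent_dag := fun s d a hs ha => by
    rcases ha with ha | ⟨p, _, _, ha⟩
    · exact (le_afterStore S src dst b).dag _ (h.sent_dag s d a hs ha)
    · simp at ha
  request_dag := fun s d a hs' hd ha => by
    rcases ha with ha | ⟨p, hp, _, ha⟩
    · exact (le_afterStore S src dst b).dag _ (h.request_dag s d a hs' hd ha)
    · simp only [Prod.mk.injEq, Msg.request.injEq] at ha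
      obtain ⟨rfl, rfl, rfl⟩ := ha
      exact (le_afterStore S d s b).dag _
        (mem_dag_of_isLink (h.sent_dag d s b hd hs) (.of_parent hp))

theorem Inv.afterPropose {S : State f Tx} (h : S.Inv) {v : Validator f} {txs : List Tx}
    {parents : List (Block f Tx)} (hm : S.MayPropose v txs parents) :
    (S.afterPropose v (.mk v (S.nextRound v) txs parents)).Inv := by
  obtain ⟨hv, -, hpar, hwf⟩ := hm
  set b : Block f Tx := .mk v (S.nextRound v) txs parents with hbdef
  have hle : S.Le (S.afterPropose v b) := le_afterPropose S v rfl
  have hpar' : ∀ p ∈ b.parents, p ∈ S.dag v := hpar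
  have hbdag : b ∈ (S.afterPropose v b).dag v := by
    refine mem_dag_of_parents ?_ fun p hp => hle.dag v (hpar' p hp)
    simp [State.afterPropose]
  have hlt : ∀ a ∈ S.signed, a.author = v → a.round < b.round := fun a ha hav => by
    have := h.signed_round a ha
    rwa [hav] at this
  have hauth : (S.afterPropose v b).Authentic b := by
    intro a ha
    obtain rfl | ⟨p, hp, hap⟩ := isLink_iff.1 ha
    · exact Or.inr (Set.mem_insert _ _)
    · exact hle.authentic (h.store_authentic v a (hpar' p hp a hap)) a (.refl a)
  refine
    { card_le := h.card_le
      signed_round := ?_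
      exists_signed := ?_
      signed_unique := ?_
      last_signed := ?_
      signed_dag := ?_
      signed_sent := ?_
      store_valid := ?_
      store_authentic := ?_
      sent_authentic := ?_
      sent_dag := ?_
      request_dag := ?_ }
  · rintro a (rfl | ha)
    · exact (Nat.lt_succ_self _).trans_eq (nextRound_afterPropose_self S v b).symm
    · exact (h.signed_round a ha).trans_le (hle.nextRound _)
  · intro u k hk
    by_cases hu : u = v
    · subst hu
      rw [nextRound_afterPropose_self] at hk
      rcases Nat.lt_succ_iff_lt_or_eq.1 hk with hk | rfl
      · obtain ⟨a, ha, hak⟩ := h.exists_signed u k hk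
        exact ⟨a, Or.inr ha, hak⟩
      · exact ⟨b, Or.inl rfl, rfl, rfl⟩
    · rw [nextRound_afterPropose_of_ne S b hu] at hk
      obtain ⟨a, ha, hak⟩ := h.exists_signed u k hk
      exact ⟨a, Or.inr ha, hak⟩
  · rintro a (rfl | ha) a' (rfl | ha') hau har
    · rfl
    · exact absurd har (hlt a' ha' hau.symm).ne'
    · exact absurd har (hlt a ha hau).ne
    · exact h.signed_unique a ha a' ha' hau har
  · intro u a ha
    by_cases hu : u = v
    · subst hu
      simp only [State.afterPropose, Function.update_self, Option.some.injEq] at ha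
      subst ha
      exact ⟨Or.inl rfl, rfl⟩
    · simp only [State.afterPropose, Function.update_of_ne hu] at ha
      obtain ⟨h1, h2⟩ := h.last_signed u a ha
      exact ⟨Or.inr h1, h2⟩
  · rintro a (rfl | ha)
    · exact hbdag
    · exact hle.dag _ (h.signed_dag a ha)
  · rintro a (rfl | ha) dst
    · exact Or.inr ⟨dst, rfl⟩
    · exact Or.inl (h.signed_sent a ha dst)
  · intro u a ha
    rcases mem_update_insert ha with ⟨_, rfl⟩ | ha
    · exact Valid.of_parents hwf fun p hp => h.store_valid v p (mem_store_of_mem_dag (hpar' p hp))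
    · exact h.store_valid u a ha
  · intro u a ha
    rcases mem_update_insert ha with ⟨_, rfl⟩ | ha
    · exact hauth
    · exact hle.authentic (h.store_authentic u a ha)
  · rintro s d a (ha | ⟨d', ha⟩)
    · exact hle.authentic (h.sent_authentic s d a ha)
    · simp only [Prod.mk.injEq, Msg.block.injEq] at ha
      obtain ⟨-, -, rfl⟩ := ha
      exact hauth
  · rintro s d a hs (ha | ⟨d', ha⟩)
    · exact hle.dag _ (h.sent_dag s d a hs ha)
    · simp only [Prod.mk.injEq, Msg.block.injEq] at ha
      obtain ⟨rfl, -, rfl⟩ := ha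
      exact hbdag
  · rintro s d a hs hd (ha | ⟨d', ha⟩)
    · exact hle.dag _ (h.request_dag s d a hs hd ha)
    · simp at ha

theorem Inv.step {S : State f Tx} (h : S.Inv) (e : Event f Tx) : (S.step e).Inv := by
  refine step_cases S e _ h (fun v hv => h.corrupt hv) (fun v txs parents hm => h.afterPropose hm)
    (fun src dst m hsrc hm => h.afterSend ?_ ?_ ?_)
    (fun src dst b hs _ hb => h.afterStore hs hb)
    (fun src dst b _ _ hb => h.afterSend ?_ ?_ ?_)
  · rintro b rfl
    exact hm
  · exact fun b hc => absurd hsrc hc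
  · exact fun b hc => absurd hsrc hc
  · rintro a ⟨⟩
    exact h.store_authentic dst b (mem_store_of_mem_dag hb)
  · rintro a _ ⟨⟩
    exact hb
  · rintro a _ _ ⟨⟩

theorem Inv.signed_valid {S : State f Tx} (h : S.Inv) {b : Block f Tx} (hb : b ∈ S.signed) :
    Valid b :=
  h.store_valid _ _ (mem_store_of_mem_dag (h.signed_dag b hb))

theorem Inv.signed_authentic {S : State f Tx} (h : S.Inv) {b : Block f Tx} (hb : b ∈ S.signed) :
    S.Authentic b :=
  h.store_authentic _ _ (mem_store_of_mem_dag (h.signed_dag b hb))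

theorem Authentic.of_isLink {S : State f Tx} {a b : Block f Tx} (h : S.Authentic b)
    (hab : IsLink a b) : S.Authentic a :=
  fun _ hc => h _ (hc.trans hab)

theorem Authentic.mem_signed {S : State f Tx} {b : Block f Tx} (h : S.Authentic b)
    (hb : b.author ∉ S.corrupted) : b ∈ S.signed :=
  (h b (.refl b)).resolve_left hb

theorem Inv.eq_of_authentic {S : State f Tx} (h : S.Inv) {a b : Block f Tx} (ha : S.Authentic a)
    (hb : S.Authentic b) (hau : a.author = b.author) (hr : a.round = b.round)
    (hc : a.author ∉ S.corrupted) : a = b :=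
  h.signed_unique a (ha.mem_signed hc) b (hb.mem_signed (hau ▸ hc)) hau hr

theorem Inv.coinOpen_of_le {S : State f Tx} (h : S.Inv) {r r' : ℕ} (hr : r ≤ r')
    (ho : S.CoinOpen 5 r') : S.CoinOpen 5 r := by
  refine Quorum.mono ho fun v hv => hv.imp id ?_
  rintro ⟨b, hb, rfl, hbr⟩
  refine h.exists_signed b.author _ (lt_of_le_of_lt ?_ (h.signed_round b hb))
  rw [hbr]
  simp only [certifyRound]
  omega

end State

end MahiMahi

namespace MahiMahi

/-! ### Consistency of the decision rule -/

section Consistency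

variable {f ℓ : ℕ} {Tx : Type u}

theorem Quorum.nonempty {P : Set (Validator f)} (hP : Quorum P) : ∃ v, v ∈ P :=
  (hP.exists_notMem (C := ∅) (by simp)).imp fun _ h => h.1

/-- A causally closed set of valid and authentic blocks. -/
def State.Sound (S : State f Tx) (D : Set (Block f Tx)) : Prop :=
  ∀ b ∈ D, Valid b ∧ S.Authentic b ∧ ∀ a, IsLink a b → a ∈ D

theorem State.Inv.sound_dag {S : State f Tx} (h : S.Inv) (v : Validator f) : S.Sound (S.dag v) :=
  fun b hb => ⟨h.store_valid v b (mem_store_of_mem_dag hb),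
    h.store_authentic v b (mem_store_of_mem_dag hb), fun _ => mem_dag_of_isLink hb⟩

theorem State.Sound.mono {S S' : State f Tx} {D : Set (Block f Tx)} (h : S.Sound D)
    (hS : S.Le S') : S'.Sound D :=
  fun b hb => ⟨(h b hb).1, hS.authentic (h b hb).2.1, (h b hb).2.2⟩

theorem Valid.quorum_history {k : ℕ} : ∀ {a : Block f Tx}, Valid a → k < a.round →
    Quorum {v | ∃ b, IsLink b a ∧ b.author = v ∧ b.round = k} := by
  suffices ∀ n, ∀ a : Block f Tx, a.round = n → Valid a → k < a.round →
      Quorum {v | ∃ b, IsLink b a ∧ b.author = v ∧ b.round = k} from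
    fun {a} => this _ a rfl
  intro n
  induction n with
  | zero => intro a ha _ hk; omega
  | succ n ih =>
    intro a ha hv hk
    have hq := hv.wellFormed.2.2 (by omega)
    by_cases hkn : k = n
    · refine hq.mono ?_
      rintro v ⟨p, hp, hpv, hpr⟩
      exact ⟨p, .of_parent hp, hpv, by omega⟩
    · obtain ⟨v, p, hp, -, hpr⟩ := hq.nonempty
      refine (ih p (by omega) (hv.of_isLink (.of_parent hp)) (by omega)).mono ?_
      rintro v ⟨b, hb, hbv⟩
      exact ⟨b, hb.trans (.of_parent hp), hbv⟩

theorem IsCert.isLink {w : ℕ} {x b : Block f Tx} (h : IsCert w x b) : IsLink b x := by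
  obtain ⟨v, p, hp, -, -, hv⟩ := Quorum.nonempty h
  exact hv.isLink.trans (.of_parent hp)

theorem State.Inv.eq_of_isCert {S : State f Tx} (hS : S.Inv) {x y b b' : Block f Tx}
    (hx : S.Authentic x) (hy : S.Authentic y) (hxb : IsCert 5 x b) (hyb : IsCert 5 y b')
    (ha : b.author = b'.author) (hr : b.round = b'.round) : b = b' := by
  obtain ⟨v, ⟨p, hp, hpv, hpr, hpb⟩, ⟨q, hq, hqv, hqr, hqb⟩, hv⟩ :=
    Quorum.exists_mem_inter hxb hyb hS.card_le
  have hpq : p = q := hS.eq_of_authentic (hx.of_isLink (.of_parent hp))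
    (hy.of_isLink (.of_parent hq)) (by rw [hpv, hqv]) (by rw [hpr, hqr, hr]) (by rwa [hpv])
  subst hpq
  exact hpb.eq_of_same_slot hqb ha hr

theorem State.Inv.not_isCert_of_directSkip {S : State f Tx} (hS : S.Inv) {D : Set (Block f Tx)}
    (hD : S.Sound D) {c : ℕ → Leaders f ℓ} {s : Slot ℓ} (hs : DirectSkip 5 c D s)
    {x b : Block f Tx} (hx : S.Authentic x) (ha : b.author = c s.1 s.2) (hr : b.round = s.1) :
    ¬ IsCert 5 x b := by
  intro hxb
  obtain ⟨-, hq, hskip⟩ := hs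
  have key : ∀ p ∈ D, p.author ∉ S.corrupted → p.round = voteRound 5 b.round →
      ∀ q ∈ x.parents, q.author = p.author → q.round = voteRound 5 b.round → q = p :=
    fun p hp hc hpr q hq hqa hqr => hS.eq_of_authentic (hx.of_isLink (.of_parent hq))
      (hD p hp).2.1 hqa (hqr.trans hpr.symm) (by rwa [hqa])
  have hbD : b ∈ D := by
    obtain ⟨v, ⟨p, hp, hpv, hpr⟩, ⟨q, hq, hqv, hqr, hqb⟩, hv⟩ :=
      Quorum.exists_mem_inter hq hxb hS.card_le
    have := key p hp (by rwa [hpv]) (by rw [hpr, hr]) q hq (by rw [hpv, hqv]) hqr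
    subst this
    exact (hD q hp).2.2 b hqb.isLink
  obtain ⟨v, ⟨p, hp, hpv, hpr, hpb⟩, ⟨q, hq, hqv, hqr, hqb⟩, hv⟩ :=
    Quorum.exists_mem_inter (hskip b ⟨hbD, ha, hr⟩) hxb hS.card_le
  have := key p hp (by rwa [hpv]) hpr q hq (by rw [hpv, hqv]) hqr
  subst this
  exact hpb hqb

theorem State.Inv.exists_cert_of_directCommit {S : State f Tx} (hS : S.Inv)
    {D : Set (Block f Tx)} (hD : S.Sound D) {c : ℕ → Leaders f ℓ} {s : Slot ℓ} {a b : Block f Tx}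
    (hs : DirectCommit 5 c D s b) (ha : Valid a) (haS : S.Authentic a)
    (hr : certifyRound 5 s.1 < a.round) :
    ∃ x, IsLink x a ∧ x.round = certifyRound 5 b.round ∧ IsCert 5 x b := by
  obtain ⟨-, hb, hsup⟩ := hs
  rw [← hb.2.2] at hr
  obtain ⟨v, ⟨p, hp, hpv, hpr, hpb⟩, ⟨q, hq, hqv, hqr⟩, hv⟩ :=
    Quorum.exists_mem_inter hsup (ha.quorum_history hr) hS.card_le
  have hpq : q = p := hS.eq_of_authentic (haS.of_isLink hq)
    (hD p hp).2.1 (by rw [hpv, hqv]) (by rw [hpr, hqr]) (by rwa [hqv])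
  subst hpq
  exact ⟨q, hq, hpr, hpb⟩

theorem State.Sound.isCertifiedLink {S : State f Tx} {D : Set (Block f Tx)} (hD : S.Sound D)
    {a x b : Block f Tx} (ha : a ∈ D) (hx : IsLink x a) (hr : x.round = certifyRound 5 b.round)
    (hb : IsCert 5 x b) : IsCertifiedLink 5 D a b ∧ b ∈ D :=
  ⟨⟨x, (hD a ha).2.2 x hx, hr, hb, hx⟩, (hD a ha).2.2 b (hb.isLink.trans hx)⟩

theorem Status.mem_slotBlocks {w : ℕ} {c : ℕ → Leaders f ℓ} {D : Set (Block f Tx)} {s : Slot ℓ}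
    {b : Block f Tx} (h : Status w c D s (some b)) : b ∈ slotBlocks c D s := by
  cases h with
  | directCommit _ _ h => exact h.2.1
  | indirectCommit _ _ _ _ _ _ _ _ _ hb _ => exact hb

theorem Status.exists_isCert {w : ℕ} {c : ℕ → Leaders f ℓ} {D : Set (Block f Tx)} {s : Slot ℓ}
    {b : Block f Tx} (h : Status w c D s (some b)) : ∃ x ∈ D, IsCert w x b := by
  cases h with
  | directCommit _ _ h =>
    obtain ⟨v, x, hx, -, -, hxb⟩ := h.2.2.nonempty
    exact ⟨x, hx, hxb⟩
  | indirectCommit _ _ _ _ _ _ _ _ _ _ hl =>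
    obtain ⟨x, hx, -, hxb, -⟩ := hl
    exact ⟨x, hx, hxb⟩

theorem Slot.before_trichotomy (s s' : Slot ℓ) : s.Before s' ∨ s = s' ∨ s'.Before s := by
  obtain ⟨r, i⟩ := s
  obtain ⟨r', i'⟩ := s'
  simp only [Slot.Before, Prod.mk.injEq]
  rcases lt_trichotomy r r' with h | h | h <;> rcases lt_trichotomy i i' with h' | h' | h' <;>
    simp [h, h']

theorem State.Inv.status_unique {S : State f Tx} (hS : S.Inv) {D D' : Set (Block f Tx)}
    (hD : S.Sound D) (hD' : S.Sound D') {c : ℕ → Leaders f ℓ} {s : Slot ℓ}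
    {o o' : Option (Block f Tx)} (h : Status 5 c D s o) (h' : Status 5 c D' s o') : o = o' := by
  have eq_of_some : ∀ {s b b'}, Status 5 c D s (some b) → Status 5 c D' s (some b') →
      some b = some b' := by
    intro s b b' h h'
    obtain ⟨x, hx, hxb⟩ := h.exists_isCert
    obtain ⟨y, hy, hyb⟩ := h'.exists_isCert
    rw [hS.eq_of_isCert (hD x hx).2.1 (hD' y hy).2.1 hxb hyb
      (h.mem_slotBlocks.2.1.trans h'.mem_slotBlocks.2.1.symm)
      (h.mem_slotBlocks.2.2.trans h'.mem_slotBlocks.2.2.symm)]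
  have not_directSkip : ∀ {E E' : Set (Block f Tx)} {s b}, S.Sound E → S.Sound E' →
      Status 5 c E s (some b) → ¬ DirectSkip 5 c E' s := by
    intro E E' s b hE hE' h hs
    obtain ⟨x, hx, hxb⟩ := h.exists_isCert
    exact hS.not_isCert_of_directSkip hE' hs (hE x hx).2.1 h.mem_slotBlocks.2.1
      h.mem_slotBlocks.2.2 hxb
  have not_directCommit : ∀ {E E' : Set (Block f Tx)} {s b anchor a}, S.Sound E → S.Sound E' →
      DirectCommit 5 c E s b → certifyRound 5 s.1 < anchor.1 → Status 5 c E' anchor (some a) →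
      ¬ ∀ b ∈ slotBlocks c E' s, ¬ IsCertifiedLink 5 E' a b := by
    intro E E' s b anchor a hE hE' h hr ha hl
    have haE := ha.mem_slotBlocks
    obtain ⟨x, hxa, hxr, hxb⟩ := hS.exists_cert_of_directCommit hE h (hE' a haE.1).1
      (hE' a haE.1).2.1 (haE.2.2 ▸ hr)
    obtain ⟨h1, h2⟩ := hE'.isCertifiedLink haE.1 hxa hxr hxb
    exact hl b ⟨h2, h.2.1.2⟩ h1
  have not_skip : ∀ {E E' : Set (Block f Tx)} {s b a}, S.Sound E' → b ∈ slotBlocks c E s →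
      IsCertifiedLink 5 E a b → a ∈ E' → ¬ ∀ b ∈ slotBlocks c E' s, ¬ IsCertifiedLink 5 E' a b := by
    intro E E' s b a hE' hb hab ha hl
    obtain ⟨x, -, hxr, hxb, hxa⟩ := hab
    obtain ⟨h1, h2⟩ := hE'.isCertifiedLink ha hxa hxr hxb
    exact hl b ⟨h2, hb.2⟩ h1
  induction h generalizing o' with
  | directCommit s b h =>
    cases h' with
    | directCommit _ b' h' => exact eq_of_some (.directCommit s b h) (.directCommit s b' h')
    | directSkip _ h' => exact absurd h' (not_directSkip hD hD' (.directCommit s b h))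
    | indirectCommit _ anchor a b' hu hr hskip ha hcoin hb hl =>
      exact eq_of_some (.directCommit s b h)
        (.indirectCommit s anchor a b' hu hr hskip ha hcoin hb hl)
    | indirectSkip _ anchor a hu hr hskip ha hcoin hl =>
      exact absurd hl (not_directCommit hD hD' h hr ha)
  | directSkip s h =>
    cases o' with
    | none => rfl
    | some b' => exact absurd h (not_directSkip hD' hD h')
  | indirectCommit s anchor a b hu hr hskip ha hcoin hb hl ihskip iha =>
    have h := Status.indirectCommit s anchor a b hu hr hskip ha hcoin hb hl
    cases o' with
    | some b' => exact eq_of_some h h'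
    | none =>
      cases h' with
      | directSkip _ h' => exact absurd h' (not_directSkip hD hD' h)
      | indirectSkip _ anchor' a' hu' hr' hskip' ha' hcoin' hl' =>
        rcases anchor.before_trichotomy anchor' with hlt | rfl | hlt
        · exact absurd (iha (hskip' anchor hr hlt)) (by simp)
        · have := iha ha'
          simp only [Option.some.injEq] at this
          subst this
          exact absurd hl' (not_skip hD' hb hl ha'.mem_slotBlocks.1)
        · exact absurd (ihskip anchor' hr' hlt ha') (by simp)
  | indirectSkip s anchor a hu hr hskip ha hcoin hl ihskip iha =>
    cases h' with
    | directCommit _ b' h' => exact absurd hl (not_directCommit hD' hD h' hr ha)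
    | directSkip _ _ => rfl
    | indirectSkip _ _ _ _ _ _ _ _ _ => rfl
    | indirectCommit _ anchor' a' b' hu' hr' hskip' ha' hcoin' hb' hl' =>
      rcases anchor.before_trichotomy anchor' with hlt | rfl | hlt
      · exact absurd (iha (hskip' anchor hr hlt)) (by simp)
      · have := iha ha'
        simp only [Option.some.injEq] at this
        subst this
        exact absurd hl (not_skip hD hb' hl' ha.mem_slotBlocks.1)
      · exact absurd (ihskip anchor' hr' hlt ha') (by simp)

/-! ### Five directly committed rounds decide all earlier slots -/

theorem Slot.exists_minimal (P : Slot ℓ → Prop) {s : Slot ℓ} (hs : P s) :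
    ∃ m, P m ∧ (∀ s' : Slot ℓ, s'.Before m → ¬ P s') ∧ ¬ s.Before m := by
  have hwf : WellFounded fun s s' : Slot ℓ => s.Before s' := by
    refine Subrelation.wf ?_ (measure fun s : Slot ℓ => s.1 * ℓ + s.2).wf
    rintro ⟨r, i⟩ ⟨r', i'⟩ h
    change r * ℓ + i < r' * ℓ + i'
    rcases h with h | ⟨h, h'⟩
    · have h1 := Nat.mul_le_mul_right ℓ (Nat.succ_le_of_lt h)
      have := i.2
      simp only [Nat.succ_mul] at h1
      omega
    · simp only at h
      subst h
      simpa using h'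
  obtain ⟨m, hm, hmin⟩ := hwf.has_min {s | P s} ⟨s, hs⟩
  exact ⟨m, hm, fun s' hs' hP => hmin s' hP hs', hmin s hs⟩

theorem State.Inv.exists_status {S : State f Tx} (hS : S.Inv) {D : Set (Block f Tx)}
    (hD : S.Sound D) {c : ℕ → Leaders f ℓ} {R : ℕ} {i : Fin ℓ}
    (hi : ∀ j, i ≤ j) (hcoin : ∀ r < R, CoinReady 5 D r)
    (hcommit : ∀ k < 5, ∃ b, DirectCommit 5 c D (R + k, i) b) :
    ∀ s : Slot ℓ, s.1 < R → ∃ o, Status 5 c D s o := by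
  suffices ∀ n, ∀ s : Slot ℓ, s.1 < R → R - s.1 = n → ∃ o, Status 5 c D s o from
    fun s hs => this _ s hs rfl
  intro n
  induction n using Nat.strong_induction_on with
  | _ n ih =>
    intro s hs hn
    by_cases hskip : DirectSkip 5 c D s
    · exact ⟨_, .directSkip s hskip⟩
    by_cases hcom : ∃ b, DirectCommit 5 c D s b
    · obtain ⟨b, hb⟩ := hcom
      exact ⟨_, .directCommit s b hb⟩
    have hu : DirectUndecided 5 c D s := ⟨hskip, fun b hb => hcom ⟨b, hb⟩⟩
    obtain ⟨k, hk, hmax⟩ : ∃ k < 5, R + k = max R (s.1 + 5) :=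
      ⟨max R (s.1 + 5) - R, by omega, by omega⟩
    obtain ⟨l, hl⟩ := hcommit k hk
    have hl' := Status.directCommit _ _ hl
    have hc : certifyRound 5 s.1 = s.1 + 4 := rfl
    obtain ⟨m, ⟨hm1, hm2⟩, hmin, hle⟩ := Slot.exists_minimal
      (fun s' : Slot ℓ => certifyRound 5 s.1 < s'.1 ∧ ¬ Status 5 c D s' none) (s := (R + k, i))
      ⟨by rw [hc]; simp only; omega,
        fun h => absurd (hS.status_unique hD hD h hl') (by simp)⟩
    obtain ⟨a, ha⟩ : ∃ a, Status 5 c D m (some a) := by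
      rcases m.before_trichotomy (R + k, i) with h | rfl | h
      · have hlt : m.1 < R + k := h.resolve_right fun h' => absurd h'.2 (hi m.2).not_gt
        have hmR : m.1 < R := by omega
        obtain ⟨o, ho⟩ := ih (R - m.1) (by omega) m hmR rfl
        cases o with
        | none => exact absurd ho hm2
        | some a => exact ⟨a, ho⟩
      · exact ⟨l, hl'⟩
      · exact absurd h hle
    have hsk : ∀ s' : Slot ℓ, certifyRound 5 s.1 < s'.1 → s'.Before m → Status 5 c D s' none := by
      intro s' h1 h2
      by_contra h3
      exact hmin s' h2 ⟨h1, h3⟩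
    by_cases hex : ∃ b ∈ slotBlocks c D s, IsCertifiedLink 5 D a b
    · obtain ⟨b, hb, hab⟩ := hex
      exact ⟨_, .indirectCommit s m a b hu hm1 hsk ha (hcoin _ hs) hb hab⟩
    · exact ⟨_, .indirectSkip s m a hu hm1 hsk ha (hcoin _ hs) fun b hb hab => hex ⟨b, hb, hab⟩⟩

end Consistency

end MahiMahi

namespace MahiMahi

/-! ### The common core -/

namespace State

variable {f : ℕ} {Tx : Type u}

/-- The block of round `r` by the uncorrupted validator `v` is in the causal history of blocks of
round `r + 2` by so many uncorrupted validators that later rounds cannot avoid it. -/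
def IsCore (S : State f Tx) (r : ℕ) (v : Validator f) : Prop :=
  v ∉ S.corrupted ∧ ∃ b ∈ S.signed, b.author = v ∧ b.round = r ∧
    Quorum {u | u ∈ S.corrupted ∨ ∃ y ∈ S.signed, y.author = u ∧ y.round = r + 2 ∧ IsLink b y}

theorem Inv.exists_isCore {S : State f Tx} (hS : S.Inv) {r : ℕ} (hr : S.CoinOpen 5 r) :
    ∃ v, S.IsCore r v := by
  classical
  set C := S.corrupted
  set W : Finset (Validator f) :=
    Finset.univ.filter fun w => w ∉ C ∧ ∃ x ∈ S.signed, x.author = w ∧ x.round = r + 1 with hW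
  set R : Validator f → Validator f → Prop := fun w v =>
    ∃ x ∈ S.signed, x.author = w ∧ x.round = r + 1 ∧ ∃ p ∈ x.parents, p.author = v ∧ p.round = r
    with hRdef
  have hdisj : Disjoint W C :=
    Finset.disjoint_left.2 fun w hw => (Finset.mem_filter.1 hw).2.1
  have hmiss : ∀ w ∈ W, (Cᶜ.filter fun v => ¬ R w v).card ≤ f := by
    intro w hw
    obtain ⟨-, -, x, hx, hxw, hxr⟩ := Finset.mem_filter.1 hw
    have hq := (hS.signed_valid hx).wellFormed.2.2 (by omega)
    set P := {v | ∃ p ∈ x.parents, p.author = v ∧ p.round + 1 = x.round} with hP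
    have h1 : ((Cᶜ.filter fun v => ¬ R w v : Finset _) : Set (Validator f)) ⊆ Pᶜ := by
      rintro v hv ⟨p, hp, hpv, hpr⟩
      exact (Finset.mem_filter.1 hv).2 ⟨x, hx, hxw, hxr, p, hp, hpv, by omega⟩
    have h2 := Set.ncard_le_ncard h1 (Set.toFinite _)
    rw [Set.ncard_coe_finset] at h2
    have h3 := Set.ncard_add_ncard_compl P
    rw [Nat.card_eq_fintype_card, Fintype.card_fin] at h3
    unfold Quorum at hq
    omega
  obtain ⟨v, hv, hpop⟩ := exists_popular (C := C) hS.card_le hdisj R hmiss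
  have key : ∀ y ∈ S.signed, y.round = r + 2 →
      ∃ p ∈ S.signed, p.author = v ∧ p.round = r ∧ IsLink p y := by
    intro y hy hyr
    have hq := (hS.signed_valid hy).wellFormed.2.2 (by omega)
    obtain ⟨w, ⟨x, hx, hxw, hxr⟩, hw⟩ : ∃ w ∈ {v | ∃ p ∈ y.parents, p.author = v ∧
        p.round + 1 = y.round}, w ∉ (W.filter fun w => ¬ R w v) ∪ C := by
      by_contra! h
      have h1 := Set.ncard_le_ncard (t := ((((W.filter fun w => ¬ R w v) ∪ C :
        Finset (Validator f))) : Set (Validator f))) (fun w hw => h w hw) (Set.toFinite _)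
      rw [Set.ncard_coe_finset] at h1
      have h2 := Finset.card_union_le (W.filter fun w => ¬ R w v) C
      unfold Quorum at hq
      omega
    rw [Finset.mem_union, not_or] at hw
    have hxS : x ∈ S.signed :=
      ((hS.signed_authentic hy).of_isLink (.of_parent hx)).mem_signed (by rw [hxw]; exact hw.2)
    have hwW : w ∈ W := Finset.mem_filter.2 ⟨Finset.mem_univ _, hw.2, x, hxS, hxw, by omega⟩
    have hR : R w v := by
      by_contra hR
      exact hw.1 (Finset.mem_filter.2 ⟨hwW, hR⟩)
    obtain ⟨x', hx', hxw', hxr', p, hp, hpv, hpr⟩ := hR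
    have : x' = x := hS.signed_unique x' hx' x hxS (by rw [hxw, hxw']) (by omega)
    subst this
    have hpl : IsLink p x' := .of_parent hp
    exact ⟨p, ((hS.signed_authentic hx').of_isLink hpl).mem_signed (by rwa [hpv]), hpv, hpr,
      hpl.trans (.of_parent hx)⟩
  have hround : ∀ u, u ∉ C → u ∈ {v | v ∈ S.corrupted ∨
      ∃ b ∈ S.signed, b.author = v ∧ b.round = certifyRound 5 r} →
      ∃ y ∈ S.signed, y.author = u ∧ y.round = r + 2 := by
    rintro u huC (hu | ⟨y, hy, rfl, hyr⟩)
    · exact absurd hu huC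
    · refine hS.exists_signed _ _ (lt_of_le_of_lt ?_ (hS.signed_round y hy))
      rw [hyr]
      simp only [certifyRound]
      omega
  obtain ⟨u, hu, huC⟩ := Quorum.exists_notMem hr hS.card_le
  obtain ⟨y, hy, -, hyr⟩ := hround u huC hu
  obtain ⟨b, hb, hbv, hbr, -⟩ := key y hy hyr
  refine ⟨v, hv, b, hb, hbv, hbr, Quorum.mono hr fun u hu => ?_⟩
  by_cases huC : u ∈ C
  · exact Or.inl huC
  · obtain ⟨y, hy, hyu, hyr⟩ := hround u huC hu
    obtain ⟨b', hb', hbv', hbr', hby⟩ := key y hy hyr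
    have : b' = b := hS.signed_unique b' hb' b hb (by rw [hbv, hbv']) (by rw [hbr, hbr'])
    subst this
    exact Or.inr ⟨y, hy, hyu, hyr, hby⟩

/-- A member of the common core is certified by all later blocks of the Certify round, unless
further validators are corrupted. -/
theorem IsCore.exists_isCert {S : State f Tx} {r : ℕ} {v : Validator f} (h : S.IsCore r v) :
    ∃ b ∈ S.signed, b.author = v ∧ b.round = r ∧ ∀ S' : State f Tx, S.Le S' → S'.Inv →
      S'.corrupted ⊆ S.corrupted → ∀ z, Valid z → S'.Authentic z → z.round = r + 4 →
        IsCert 5 z b := by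
  obtain ⟨hv, b, hb, hbv, hbr, hq⟩ := h
  refine ⟨b, hb, hbv, hbr, fun S' hle hS' hcor z hz hzS hzr => ?_⟩
  have hvote : ∀ x, Valid x → S'.Authentic x → x.round = r + 3 → IsVote x b := by
    intro x hx hxS hxr
    obtain ⟨u, ⟨p, hp, hpu, hpr⟩, hu, huC⟩ :=
      (hx.wellFormed.2.2 (by omega)).exists_mem_inter hq hS'.card_le
    obtain ⟨y, hy, hyu, hyr, hby⟩ := hu.resolve_left fun h => huC (hle.corrupted h)
    have : p = y := hS'.signed_unique p
      ((hxS.of_isLink (.of_parent hp)).mem_signed (by rwa [hpu])) y (hle.signed hy)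
      (by rw [hpu, hyu]) (by omega)
    subst this
    refine isVote_of_unique hx (hby.trans (.of_parent hp)) (fun h => ?_) fun q hq hqa hqr => ?_
    · rw [h] at hbr
      omega
    · have hqc : q.author ∉ S'.corrupted := by
        rw [hqa, hbv]
        exact fun h => hv (hcor h)
      exact hS'.signed_unique q ((hxS.of_isLink hq).mem_signed hqc) b (hle.signed hb) hqa hqr
  refine Quorum.mono (hz.wellFormed.2.2 (by omega)) ?_
  rintro u ⟨p, hp, hpu, hpr⟩
  have hpr' : p.round = r + 3 := by omega
  exact ⟨p, hp, hpu, by rw [hpr', hbr]; rfl, hvote p (hz.of_isLink (.of_parent hp))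
    (hzS.of_isLink (.of_parent hp)) hpr'⟩

end State

end MahiMahi

namespace MahiMahi

/-! ### Runs -/

namespace State

variable {f : ℕ} {Tx : Type u}

theorem nextRound_step_le (S : State f Tx) (e : Event f Tx) (v : Validator f) :
    (S.step e).nextRound v ≤ S.nextRound v + 1 := by
  refine step_cases S e (fun S' => S'.nextRound v ≤ S.nextRound v + 1) (Nat.le_succ _)
    (fun _ _ => Nat.le_succ _) (fun u txs parents _ => ?_) (fun _ _ _ _ _ => Nat.le_succ _)
    (fun _ _ _ _ _ _ => Nat.le_succ _) (fun _ _ _ _ _ _ => Nat.le_succ _)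
  by_cases h : v = u
  · subst h
    rw [nextRound_afterPropose_self]
    rfl
  · rw [nextRound_afterPropose_of_ne _ _ h]
    exact Nat.le_succ _

theorem step_receive_block {S : State f Tx} {src dst : Validator f} {b : Block f Tx}
    (hs : (src, dst, Msg.block b) ∈ S.sent) (hd : dst ∉ S.corrupted) (hb : Valid b) :
    S.step (.receive src dst (.block b)) = S.afterStore src dst b := by
  simp only [step, process]
  rw [if_pos ⟨hs, hd⟩, if_pos hb]
  rfl

theorem step_receive_request {S : State f Tx} {src dst : Validator f} {b : Block f Tx}
    (hs : (src, dst, Msg.request b) ∈ S.sent) (hd : dst ∉ S.corrupted) (hb : b ∈ S.dag dst) :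
    S.step (.receive src dst (.request b)) = S.afterSend (dst, src, .block b) := by
  simp only [step, process]
  rw [if_pos ⟨hs, hd⟩, if_pos hb]
  rfl

end State

section Runs

open Filter

variable {f ℓ : ℕ} {Tx : Type u} {w : ℕ} {adv : Adversary f ℓ Tx} {c : ℕ → Leaders f ℓ}

theorem stateAt_succ (t : ℕ) :
    stateAt w adv c (t + 1) = (stateAt w adv c t).step (eventAt w adv c t) := rfl

theorem inv_stateAt (t : ℕ) : (stateAt w adv c t).Inv := by
  induction t with
  | zero => exact State.inv_init
  | succ t ih => exact ih.step _

theorem stateAt_le {t t' : ℕ} (h : t ≤ t') : (stateAt w adv c t).Le (stateAt w adv c t') := by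
  induction h with
  | refl => exact .refl _
  | step _ ih => exact ih.trans (State.le_step _ _)

theorem nextRound_stateAt_le (t : ℕ) (v : Validator f) :
    (stateAt w adv c t).nextRound v ≤ t := by
  induction t with
  | zero => exact le_rfl
  | succ t ih => exact (State.nextRound_step_le _ _ v).trans (Nat.succ_le_succ ih)

theorem exists_corrupted_stable :
    ∃ T, ∀ t, (stateAt w adv c t).corrupted ⊆ (stateAt w adv c T).corrupted := by
  obtain ⟨T, hT⟩ := WellFoundedGT.monotone_chain_condition
    (⟨fun t => (stateAt w adv c t).corrupted, fun _ _ h => (stateAt_le h).corrupted⟩ :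
      ℕ →o Finset (Validator f))
  refine ⟨T, fun t => ?_⟩
  rcases le_total t T with h | h
  · exact (stateAt_le h).corrupted
  · exact (hT t h).ge

theorem quorum_honest : Quorum {v | Honest w adv c v} := by
  obtain ⟨T, hT⟩ := exists_corrupted_stable (w := w) (adv := adv) (c := c)
  exact (quorum_compl (inv_stateAt T).card_le).mono fun v hv t ht => hv (hT t ht)

theorem eventually_of_mono {p : State f Tx → Prop} (hp : ∀ S S', S.Le S' → p S → p S') {t : ℕ}
    (h : p (stateAt w adv c t)) : ∀ᶠ t in atTop, p (stateAt w adv c t) :=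
  eventually_atTop.2 ⟨t, fun _ ht => hp _ _ (stateAt_le ht) h⟩

theorem eventually_mem_dag {t : ℕ} {v : Validator f} {b : Block f Tx}
    (h : b ∈ (stateAt w adv c t).dag v) : ∀ᶠ t in atTop, b ∈ (stateAt w adv c t).dag v :=
  eventually_of_mono (p := fun S => b ∈ S.dag v) (fun _ _ h hb => h.dag v hb) h

theorem ReliableLinks.eventually_mem_dag (hR : ReliableLinks w adv c) {i j : Validator f}
    (hi : Honest w adv c i) (hj : Honest w adv c j) {b : Block f Tx} {t : ℕ}
    (hs : (i, j, Msg.block b) ∈ (stateAt w adv c t).sent) :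
    ∀ᶠ t in atTop, b ∈ (stateAt w adv c t).dag j := by
  induction hn : b.round using Nat.strong_induction_on generalizing b t with
  | _ n ih =>
    obtain ⟨t₁, hs₁, he₁⟩ := hR i j hi hj _ t hs
    have hinv := inv_stateAt (w := w) (adv := adv) (c := c) t₁
    have hb : Valid b := (hinv.sound_dag i b (hinv.sent_dag i j b (hi t₁) hs₁)).1
    have hstep := stateAt_succ (w := w) (adv := adv) (c := c) t₁
    rw [he₁, State.step_receive_block hs₁ (hj t₁) hb] at hstep
    have hstore : ∀ᶠ t in atTop, b ∈ (stateAt w adv c t).store j := by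
      refine eventually_of_mono (p := fun S => b ∈ S.store j) (fun _ _ h hb => h.store j hb)
        (t := t₁ + 1) ?_
      rw [hstep]
      simp [State.afterStore]
    have hpar : ∀ᶠ t in atTop, ∀ p ∈ {p | p ∈ b.parents}, p ∈ (stateAt w adv c t).dag j := by
      rw [eventually_all_finite (List.finite_toSet _)]
      intro p hp
      by_cases hpj : p ∈ (stateAt w adv c t₁).dag j
      · exact MahiMahi.eventually_mem_dag hpj
      · have hreq : (j, i, Msg.request p) ∈ (stateAt w adv c (t₁ + 1)).sent := by
          rw [hstep]
          exact Or.inr ⟨p, hp, hpj, rfl⟩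
        obtain ⟨t₂, hs₂, he₂⟩ := hR j i hj hi _ _ hreq
        have hpi := (inv_stateAt t₂).request_dag j i p (hj t₂) (hi t₂) hs₂
        have hstep₂ := stateAt_succ (w := w) (adv := adv) (c := c) t₂
        rw [he₂, State.step_receive_request hs₂ (hi t₂) hpi] at hstep₂
        refine ih p.round (hn ▸ hb.wellFormed.2.1 p hp) (t := t₂ + 1) ?_ rfl
        rw [hstep₂]
        exact Or.inl rfl
    filter_upwards [hstore, hpar] with t h1 h2
    exact State.mem_dag_of_parents h1 h2

theorem ReliableLinks.eventually_mem_dag_of_signed (hR : ReliableLinks w adv c)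
    {j : Validator f} (hj : Honest w adv c j) {b : Block f Tx} {t : ℕ}
    (hb : b ∈ (stateAt w adv c t).signed) (hi : Honest w adv c b.author) :
    ∀ᶠ t in atTop, b ∈ (stateAt w adv c t).dag j :=
  hR.eventually_mem_dag hi hj ((inv_stateAt t).signed_sent b hb j)

theorem ReliableLinks.eventually_exists_mem_dag (hR : ReliableLinks w adv c) {i j : Validator f}
    (hi : Honest w adv c i) (hj : Honest w adv c j) {r : ℕ}
    (hr : ∃ t, r < (stateAt w adv c t).nextRound i) :
    ∀ᶠ t in atTop, ∃ b ∈ (stateAt w adv c t).dag j, b.author = i ∧ b.round = r := by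
  obtain ⟨t, ht⟩ := hr
  obtain ⟨b, hb, rfl, hbr⟩ := (inv_stateAt t).exists_signed i r ht
  filter_upwards [hR.eventually_mem_dag_of_signed hj hb hi] with t h
  exact ⟨b, h, rfl, hbr⟩

/-- A validator whose local DAG has blocks of its last round by a quorum can create its next
block. -/
theorem State.Inv.exists_mayPropose {S : State f Tx} (hS : S.Inv) {v : Validator f}
    (hv : v ∉ S.corrupted) {b₀ : Block f Tx} (hlast : S.last v = some b₀)
    {Q : Set (Validator f)} (hQ : Quorum Q)
    (h : ∀ u ∈ Q, ∃ b ∈ S.dag v, b.author = u ∧ b.round = b₀.round) :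
    ∃ txs parents, S.MayPropose v txs parents := by
  classical
  have : Nonempty (Block f Tx) := ⟨b₀⟩
  choose! g hg using h
  obtain ⟨hb₀, hb₀v⟩ := hS.last_signed v b₀ hlast
  set l := ((Q.toFinite.toFinset.image g).erase b₀).toList with hl
  have hmem : ∀ p, p ∈ l ↔ p ≠ b₀ ∧ ∃ u ∈ Q, g u = p := fun p => by
    simp [hl]
  have hnext : S.nextRound v = b₀.round + 1 := by
    simp [State.nextRound, hlast]
  refine ⟨[], b₀ :: l, hv, by simp [hlast], ?_, ?_, ?_, ?_⟩
  · intro p hp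
    rcases List.mem_cons.1 hp with rfl | hp
    · have := hS.signed_dag p hb₀
      rwa [hb₀v] at this
    · obtain ⟨-, u, hu, rfl⟩ := (hmem p).1 hp
      exact (hg u hu).1
  · exact List.nodup_cons.2 ⟨fun h => ((hmem b₀).1 h).1 rfl, Finset.nodup_toList _⟩
  · intro p hp
    simp only [Block.round, hnext]
    rcases List.mem_cons.1 hp with rfl | hp
    · exact Nat.lt_succ_self _
    · obtain ⟨-, u, hu, rfl⟩ := (hmem p).1 hp
      exact ((hg u hu).2.2).trans_lt (Nat.lt_succ_self _)
  · intro _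
    refine hQ.mono fun u hu => ⟨g u, ?_, (hg u hu).2.1, ?_⟩
    · by_cases h : g u = b₀
      · exact List.mem_cons.2 (Or.inl h)
      · exact List.mem_cons.2 (Or.inr ((hmem _).2 ⟨h, u, hu, rfl⟩))
    · rw [(hg u hu).2.2]
      exact hnext.symm

theorem HonestProgress.exists_lt_nextRound (hP : HonestProgress w adv c)
    (hR : ReliableLinks w adv c) (r : ℕ) :
    ∀ v, Honest w adv c v → ∃ t, r < (stateAt w adv c t).nextRound v := by
  induction r with
  | zero =>
    intro v hv
    obtain ⟨t, ht⟩ := hP v hv 0 ⟨[], [], hv 0, rfl, by simp, by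
      refine ⟨by simp [Block.parents], by simp [Block.parents], ?_⟩
      intro h
      exact absurd h (lt_irrefl 0)⟩
    exact ⟨t, (Nat.zero_le _).trans_lt ht⟩
  | succ r ih =>
    intro v hv
    have h1 : ∀ᶠ t in atTop, ∀ u ∈ {u | Honest w adv c u},
        ∃ b ∈ (stateAt w adv c t).dag v, b.author = u ∧ b.round = r := by
      rw [eventually_all_finite (Set.toFinite _)]
      exact fun u hu => hR.eventually_exists_mem_dag hu hv (ih u hu)
    have h2 : ∀ᶠ t in atTop, r < (stateAt w adv c t).nextRound v := by
      obtain ⟨t, ht⟩ := ih v hv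
      exact eventually_of_mono (p := fun S => r < S.nextRound v)
        (fun _ _ h hr => hr.trans_le (h.nextRound v)) ht
    obtain ⟨t, ht1, ht2⟩ := (h1.and h2).exists
    rcases (Nat.succ_le_of_lt ht2).lt_or_eq with h | h
    · exact ⟨t, h⟩
    · obtain ⟨b₀, hb₀⟩ : ∃ b₀, (stateAt w adv c t).last v = some b₀ := by
        cases hl : (stateAt w adv c t).last v with
        | none => simp [State.nextRound, hl] at h
        | some b₀ => exact ⟨b₀, rfl⟩
      have hb₀r : b₀.round = r := by
        simpa [State.nextRound, hb₀] using h.symm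
      obtain ⟨t', ht'⟩ := hP v hv t
        ((inv_stateAt t).exists_mayPropose (hv t) hb₀ quorum_honest (hb₀r ▸ ht1))
      exact ⟨t', h.trans_lt ht'⟩

theorem HonestProgress.eventually_forall_honest (hP : HonestProgress w adv c)
    (hR : ReliableLinks w adv c) (r : ℕ) {j : Validator f} (hj : Honest w adv c j) :
    ∀ᶠ t in atTop, ∀ u, Honest w adv c u →
      ∃ b ∈ (stateAt w adv c t).dag j, b.author = u ∧ b.round = r := by
  have := (eventually_all_finite (Set.toFinite {u | Honest w adv c u})).2 fun u hu =>
    hR.eventually_exists_mem_dag hu hj (hP.exists_lt_nextRound hR r u hu)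
  exact this

theorem HonestProgress.eventually_coinReady (hP : HonestProgress w adv c)
    (hR : ReliableLinks w adv c) (r : ℕ) {j : Validator f} (hj : Honest w adv c j) :
    ∀ᶠ t in atTop, CoinReady w ((stateAt w adv c t).dag j) r := by
  filter_upwards [hP.eventually_forall_honest hR (certifyRound w r) hj] with t ht
  exact quorum_honest.mono fun u hu => ht u hu

theorem HonestProgress.exists_coinOpen (hP : HonestProgress w adv c)
    (hR : ReliableLinks w adv c) (r : ℕ) : ∃ t, (stateAt w adv c t).CoinOpen w r := by
  have : ∀ᶠ t in atTop, ∀ u ∈ {u | Honest w adv c u},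
      certifyRound w r < (stateAt w adv c t).nextRound u := by
    rw [eventually_all_finite (Set.toFinite _)]
    intro u hu
    obtain ⟨t, ht⟩ := hP.exists_lt_nextRound hR (certifyRound w r) u hu
    exact eventually_of_mono (p := fun S => certifyRound w r < S.nextRound u)
      (fun _ _ h hr => hr.trans_le (h.nextRound u)) ht
  obtain ⟨t, ht⟩ := this.exists
  exact ⟨t, quorum_honest.mono fun u hu => Or.inr ((inv_stateAt t).exists_signed u _ (ht u hu))⟩

theorem lt_of_coinOpen {t r : ℕ} (h : (stateAt 5 adv c t).CoinOpen 5 r) : r < t := by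
  obtain ⟨v, hv, hvC⟩ := Quorum.exists_notMem h (inv_stateAt t).card_le
  obtain ⟨b, hb, -, hbr⟩ := hv.resolve_left hvC
  have h1 := (inv_stateAt t).signed_round b hb
  have h2 := nextRound_stateAt_le (w := 5) (adv := adv) (c := c) t b.author
  simp only [certifyRound] at hbr
  omega

/-- Once no validator gets corrupted any more, a leader in the common core is directly committed
by all honest validators. -/
theorem HonestProgress.eventually_directCommit (hP : HonestProgress 5 adv c)
    (hR : ReliableLinks 5 adv c) {t₀ r : ℕ} {i : Fin ℓ}
    (hstable : ∀ t, (stateAt 5 adv c t).corrupted ⊆ (stateAt 5 adv c t₀).corrupted)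
    (hcore : (stateAt 5 adv c t₀).IsCore r (c r i)) {j : Validator f}
    (hj : Honest 5 adv c j) :
    ∀ᶠ t in atTop, ∃ b, DirectCommit 5 c ((stateAt 5 adv c t).dag j) (r, i) b := by
  obtain ⟨b, hb, hba, hbr, hcert⟩ := hcore.exists_isCert
  have hhon : Honest 5 adv c b.author := fun t ht => hcore.1 (hba ▸ hstable t ht)
  filter_upwards [hP.eventually_coinReady hR r hj, hR.eventually_mem_dag_of_signed hj hb hhon,
    hP.eventually_forall_honest hR (r + 4) hj, eventually_ge_atTop t₀] with t h1 h2 h3 h4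
  refine ⟨b, h1, ⟨h2, hba, hbr⟩, (quorum_honest (w := 5) (adv := adv) (c := c)).mono fun u hu => ?_⟩
  obtain ⟨z, hz, hzu, hzr⟩ := h3 u hu
  obtain ⟨hzv, hzS, -⟩ := (inv_stateAt t).sound_dag j z hz
  exact ⟨z, hz, hzu, by rw [hzr, hbr]; rfl,
    hcert _ (stateAt_le h4) (inv_stateAt t) (hstable t) z hzv hzS hzr⟩

/-! ### Predicting a core leader before the coin is opened -/

open Classical in
/-- A member of the common core of round `r` at the time when the coin of round `r` is opened. -/
noncomputable def coreLeader (adv : Adversary f ℓ Tx) (r : ℕ) (c : ℕ → Leaders f ℓ) :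
    Validator f :=
  if h : ∃ t, (stateAt 5 adv c t).CoinOpen 5 r then
    Classical.epsilon ((stateAt 5 adv c (Nat.find h)).IsCore r)
  else 0

theorem exists_isCore_coreLeader {r : ℕ} (h : ∃ t, (stateAt 5 adv c t).CoinOpen 5 r) :
    ∃ t, r < t ∧ (stateAt 5 adv c t).IsCore r (coreLeader adv r c) := by
  classical
  refine ⟨Nat.find h, lt_of_coinOpen (Nat.find_spec h), ?_⟩
  rw [coreLeader, dif_pos h]
  exact Classical.epsilon_spec ((inv_stateAt (Nat.find h)).exists_isCore (Nat.find_spec h))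

theorem run_congr {c' : ℕ → Leaders f ℓ} {r : ℕ} (hc : ∀ k < r, c k = c' k) :
    ∀ t, (∀ t' < t, ¬ (stateAt 5 adv c t').CoinOpen 5 r) → run 5 adv c t = run 5 adv c' t := by
  intro t
  induction t with
  | zero => exact fun _ => rfl
  | succ t ih =>
    intro h
    have hrun := ih fun t' ht' => h t' (ht'.trans (Nat.lt_succ_self t))
    have hvis : (run 5 adv c t).2.visibleCoins 5 c = (run 5 adv c t).2.visibleCoins 5 c' := by
      funext k
      unfold State.visibleCoins
      by_cases hk : (run 5 adv c t).2.CoinOpen 5 k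
      · rw [if_pos hk, if_pos hk, hc k]
        by_contra hkr
        exact h t (Nat.lt_succ_self t)
          ((inv_stateAt (w := 5) (adv := adv) (c := c) t).coinOpen_of_le (not_lt.1 hkr) hk)
      · rw [if_neg hk, if_neg hk]
    simp only [run]
    rw [hvis, hrun]

theorem coreLeader_congr {c' : ℕ → Leaders f ℓ} {r : ℕ} (hc : ∀ k < r, c k = c' k) :
    coreLeader adv r c = coreLeader adv r c' := by
  classical
  by_cases h : ∃ t, (stateAt 5 adv c t).CoinOpen 5 r
  · have heq : ∀ t ≤ Nat.find h, stateAt 5 adv c t = stateAt 5 adv c' t := fun t ht =>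
      congrArg Prod.snd (run_congr hc t fun t' ht' => Nat.find_min h (ht'.trans_le ht))
    have h' : ∃ t, (stateAt 5 adv c' t).CoinOpen 5 r :=
      ⟨Nat.find h, heq _ le_rfl ▸ Nat.find_spec h⟩
    have hfind : Nat.find h' = Nat.find h := by
      refine (Nat.find_eq_iff h').2 ⟨heq _ le_rfl ▸ Nat.find_spec h, fun t ht ho => ?_⟩
      rw [← heq t ht.le] at ho
      exact Nat.find_min h ht ho
    rw [coreLeader, coreLeader, dif_pos h, dif_pos h', hfind, heq _ le_rfl]
  · have heq : ∀ t, stateAt 5 adv c t = stateAt 5 adv c' t := fun t =>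
      congrArg Prod.snd (run_congr hc t fun t' _ ho => h ⟨t', ho⟩)
    have h' : ¬ ∃ t, (stateAt 5 adv c' t).CoinOpen 5 r := fun ⟨t, ht⟩ => h ⟨t, heq t ▸ ht⟩
    rw [coreLeader, coreLeader, dif_neg h, dif_neg h']

theorem HonestProgress.eventually_exists_status (hP : HonestProgress 5 adv c)
    (hR : ReliableLinks 5 adv c) {i : Fin ℓ} (hi : ∀ k, i ≤ k)
    (hlucky : ∀ m, ∃ R ≥ m, ∀ k < 5, c (R + k) i = coreLeader adv (R + k) c) {j : Validator f}
    (hj : Honest 5 adv c j) (m : ℕ) :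
    ∀ᶠ t in atTop, ∀ s : Slot ℓ, s.1 ≤ m →
      ∃ o, Status 5 c ((stateAt 5 adv c t).dag j) s o := by
  obtain ⟨T, hT⟩ := exists_corrupted_stable (w := 5) (adv := adv) (c := c)
  obtain ⟨R, hRm, hlucky⟩ := hlucky (max T (m + 1))
  have hcommit : ∀ᶠ t in atTop, ∀ k ∈ Set.Iio 5,
      ∃ b, DirectCommit 5 c ((stateAt 5 adv c t).dag j) (R + k, i) b := by
    rw [eventually_all_finite (Set.finite_Iio 5)]
    intro k hk
    obtain ⟨t₀, ht₀, hcore⟩ := exists_isCore_coreLeader (hP.exists_coinOpen hR (R + k))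
    rw [← hlucky k hk] at hcore
    exact hP.eventually_directCommit hR
      (fun t => (hT t).trans (stateAt_le (by omega)).corrupted) hcore hj
  have hcoin : ∀ᶠ t in atTop, ∀ r ∈ Set.Iio R, CoinReady 5 ((stateAt 5 adv c t).dag j) r := by
    rw [eventually_all_finite (Set.finite_Iio R)]
    exact fun r _ => hP.eventually_coinReady hR r hj
  filter_upwards [hcommit, hcoin] with t h1 h2 s hs
  exact (inv_stateAt t).exists_status ((inv_stateAt t).sound_dag j) hi h2 h1 s (by omega)

theorem HonestProgress.delivers (hP : HonestProgress 5 adv c) (hR : ReliableLinks 5 adv c)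
    {i₀ : Fin ℓ} (hi₀ : ∀ k, i₀ ≤ k)
    (hlucky : ∀ m, ∃ R ≥ m, ∀ k < 5, c (R + k) i₀ = coreLeader adv (R + k) c)
    {i j : Validator f} (hj : Honest 5 adv c j) {b : Block f Tx} (hb : Delivers 5 adv c i b) :
    Delivers 5 adv c j b := by
  obtain ⟨t, s, ⟨l, hl, hbl⟩, hdec, hfirst⟩ := hb
  obtain ⟨t', ht'⟩ := (hP.eventually_exists_status hR hi₀ hlucky hj s.1).exists
  have hDi := ((inv_stateAt t).sound_dag i).mono
    (stateAt_le (w := 5) (adv := adv) (c := c) (le_max_left t t'))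
  have hDj := ((inv_stateAt t').sound_dag j).mono
    (stateAt_le (w := 5) (adv := adv) (c := c) (le_max_right t t'))
  have hS := inv_stateAt (w := 5) (adv := adv) (c := c) (max t t')
  have hle : ∀ s' : Slot ℓ, s'.Before s → s'.1 ≤ s.1 := fun s' h =>
    h.elim (fun h => h.le) (fun h => h.1.le)
  refine ⟨t', s, ⟨l, ?_, hbl⟩, fun s' hs' => ht' s' (hle s' hs'), fun s' hs' l' hl' => ?_⟩
  · obtain ⟨o, ho⟩ := ht' s le_rfl
    rwa [hS.status_unique hDi hDj hl ho]
  · obtain ⟨o, ho⟩ := hdec s' hs'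
    have := hS.status_unique hDi hDj ho hl'
    subst this
    exact hfirst s' hs' l' ho

end Runs

end MahiMahi

/-! ### Guessing i.i.d. random variables from their past -/

namespace MahiMahi

section Guessing

variable {α V : Type*}

/-- The guesses `g R, …, g (R + K - 1)` are all correct. -/
def guessedRow (E : V → Set α) (g : ℕ → (ℕ → α) → V) (R K : ℕ) : Set (ℕ → α) :=
  {c | ∀ k < K, c (R + k) ∈ E (g (R + k) c)}

theorem DependsOn.inter {A B : Set (ℕ → α)} {s : Set ℕ} (hA : DependsOn (fun c => c ∈ A) s)
    (hB : DependsOn (fun c => c ∈ B) s) : DependsOn (fun c => c ∈ A ∩ B) s :=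
  fun _ _ h => congrArg₂ And (hA h) (hB h)

theorem dependsOn_guessedRow {E : V → Set α} {g : ℕ → (ℕ → α) → V}
    (hg : ∀ r, DependsOn (g r) (Set.Iio r)) {R K N : ℕ} (hN : R + K ≤ N) :
    DependsOn (fun c => c ∈ guessedRow E g R K) (Set.Iio N) := by
  intro c c' h
  refine propext (forall₂_congr fun k hk => ?_)
  have h1 : g (R + k) c = g (R + k) c' :=
    hg _ fun i hi => h i ((Set.mem_Iio.1 hi).trans (by omega))
  rw [h1, h (R + k) (by simp only [Set.mem_Iio]; omega)]

variable [Finite α] [MeasurableSpace α] [DiscreteMeasurableSpace α]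

theorem measurable_of_dependsOn [MeasurableSpace V] {g : (ℕ → α) → V} {N : ℕ}
    (hg : DependsOn g (Set.Iio N)) : Measurable g := by
  rcases isEmpty_or_nonempty α with hα | ⟨⟨a₀⟩⟩
  · exact measurable_of_empty g
  let ext : ((Finset.range N) → α) → ℕ → α := fun x k =>
    if h : k ∈ Finset.range N then x ⟨k, h⟩ else a₀
  have h : g = (g ∘ ext) ∘ (Finset.range N).restrict := by
    funext c
    refine hg fun k hk => ?_
    simp only [ext]
    rw [dif_pos (Finset.mem_range.2 hk)]
    rfl
  rw [h]
  exact (measurable_of_finite _).comp (Finset.measurable_restrict _)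

theorem measurableSet_of_dependsOn {A : Set (ℕ → α)} {N : ℕ}
    (hA : DependsOn (fun c => c ∈ A) (Set.Iio N)) : MeasurableSet A :=
  measurable_mem.1 (measurable_of_dependsOn hA)

variable (ν : Measure α) [IsProbabilityMeasure ν]

theorem measure_inter_eval_mem {A : Set (ℕ → α)} {N : ℕ}
    (hA : DependsOn (fun c => c ∈ A) (Set.Iio N)) (B : Set α) :
    Measure.infinitePi (fun _ : ℕ => ν) (A ∩ {c | c N ∈ B}) =
      Measure.infinitePi (fun _ : ℕ => ν) A * ν B := by
  have hind := (ProbabilityTheory.iIndepFun_infinitePi (P := fun _ : ℕ => ν)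
    (X := fun _ a => a) (fun _ => measurable_id)).indepFun_finset (Finset.range N) {N}
    (by simp) (fun i => measurable_pi_apply i)
  have hAm : ∃ A' : Set (Finset.range N → α),
      A = (fun (c : ℕ → α) (i : Finset.range N) => c i) ⁻¹' A' := by
    refine ⟨(fun (c : ℕ → α) (i : Finset.range N) => c i) '' A, ?_⟩
    refine Set.Subset.antisymm (Set.subset_preimage_image _ _) ?_
    rintro c ⟨c', hc', h⟩
    have : (c' ∈ A) = (c ∈ A) := hA fun k hk => congrFun h ⟨k, Finset.mem_range.2 hk⟩
    exact this ▸ hc'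
  obtain ⟨A', rfl⟩ := hAm
  have hB : {c : ℕ → α | c N ∈ B} = (fun (c : ℕ → α) (i : ({N} : Finset ℕ)) => c i) ⁻¹'
      {x | x ⟨N, by simp⟩ ∈ B} := rfl
  have hBm : MeasurableSet {x : ({N} : Finset ℕ) → α | x ⟨N, by simp⟩ ∈ B} :=
    (measurable_pi_apply (⟨N, by simp⟩ : ({N} : Finset ℕ))) (MeasurableSet.of_discrete (s := B))
  have hν : Measure.infinitePi (fun _ : ℕ => ν) {c | c N ∈ B} = ν B := by
    have h := Measure.infinitePi_map_eval (fun _ : ℕ => ν) N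
    have h' := Measure.map_apply (μ := Measure.infinitePi fun _ : ℕ => ν)
      (measurable_pi_apply N) (MeasurableSet.of_discrete (s := B))
    rw [h] at h'
    exact h'.symm
  rw [← hν, hB]
  exact hind.measure_inter_preimage_eq_mul _ _ (Set.toFinite A').measurableSet hBm

variable {ν} {p : ENNReal}

theorem measure_inter_guess [Finite V] {E : V → Set α} (hE : ∀ v, ν (E v) = p)
    {A : Set (ℕ → α)} {N : ℕ} (hA : DependsOn (fun c => c ∈ A) (Set.Iio N)) {g : (ℕ → α) → V}
    (hg : DependsOn g (Set.Iio N)) :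
    Measure.infinitePi (fun _ : ℕ => ν) (A ∩ {c | c N ∈ E (g c)}) =
      Measure.infinitePi (fun _ : ℕ => ν) A * p := by
  classical
  have := Fintype.ofFinite V
  set μ := Measure.infinitePi (fun _ : ℕ => ν)
  let _ : MeasurableSpace V := ⊤
  have hgm : ∀ v, MeasurableSet (g ⁻¹' {v}) := fun v =>
    measurable_of_dependsOn hg (MeasurableSpace.measurableSet_top)
  have hfib : ∀ S : Set (ℕ → α), μ S = ∑ v, μ (g ⁻¹' {v} ∩ S) := fun S => by
    have := sum_measure_preimage_singleton (μ := μ.restrict S) (f := g) Finset.univ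
      fun v _ => hgm v
    simp only [Finset.coe_univ, Set.preimage_univ, Measure.restrict_apply_univ] at this
    rw [← this]
    exact Finset.sum_congr rfl fun v _ => Measure.restrict_apply (hgm v)
  rw [hfib, hfib A, Finset.sum_mul]
  refine Finset.sum_congr rfl fun v _ => ?_
  have hset : g ⁻¹' {v} ∩ (A ∩ {c | c N ∈ E (g c)}) = (g ⁻¹' {v} ∩ A) ∩ {c | c N ∈ E v} := by
    ext c
    constructor
    · rintro ⟨rfl, h1, h2⟩
      exact ⟨⟨rfl, h1⟩, h2⟩
    · rintro ⟨⟨rfl, h1⟩, h2⟩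
      exact ⟨rfl, h1, h2⟩
  rw [hset, measure_inter_eval_mem ν ?_ (E v), hE]
  intro c c' h
  have h1 : (c ∈ A) = (c' ∈ A) := hA h
  have h2 : g c = g c' := hg h
  simp only [Set.mem_inter_iff, Set.mem_preimage, Set.mem_singleton_iff, h1, h2]

theorem measure_inter_guessedRow [Finite V] {E : V → Set α} (hE : ∀ v, ν (E v) = p)
    {g : ℕ → (ℕ → α) → V} (hg : ∀ r, DependsOn (g r) (Set.Iio r)) {A : Set (ℕ → α)} {R : ℕ}
    (hA : DependsOn (fun c => c ∈ A) (Set.Iio R)) (K : ℕ) :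
    Measure.infinitePi (fun _ : ℕ => ν) (A ∩ guessedRow E g R K) =
      Measure.infinitePi (fun _ : ℕ => ν) A * p ^ K := by
  induction K with
  | zero =>
    have : guessedRow E g R 0 = Set.univ := by
      ext c
      simp [guessedRow]
    rw [this, Set.inter_univ, pow_zero, mul_one]
  | succ K ih =>
    have h : A ∩ guessedRow E g R (K + 1) =
        (A ∩ guessedRow E g R K) ∩ {c | c (R + K) ∈ E (g (R + K) c)} := by
      ext c
      constructor
      · exact fun ⟨h1, h2⟩ => ⟨⟨h1, fun k hk => h2 k (by omega)⟩, h2 K (by omega)⟩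
      · rintro ⟨⟨h1, h2⟩, h3⟩
        refine ⟨h1, fun k hk => ?_⟩
        rcases Nat.lt_succ_iff_lt_or_eq.1 hk with hk | rfl
        · exact h2 k hk
        · exact h3
    rw [h, measure_inter_guess hE (DependsOn.inter (fun c c' hc => hA fun i hi => hc i ?_)
      (dependsOn_guessedRow hg le_rfl)) (hg _), ih, pow_succ, mul_assoc]
    exact (Set.mem_Iio.1 hi).trans_le (Nat.le_add_right R K)

/-- If guesses based on the past are correct with a fixed positive probability, then almost surely
there are arbitrarily late rows of `K` correct guesses. -/
theorem ae_exists_guessedRow [Finite V] {E : V → Set α} (hE : ∀ v, ν (E v) = p) (hp : p ≠ 0)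
    {g : ℕ → (ℕ → α) → V} (hg : ∀ r, DependsOn (g r) (Set.Iio r)) (K : ℕ) :
    ∀ᵐ c ∂(Measure.infinitePi fun _ : ℕ => ν), ∀ m, ∃ R ≥ m, c ∈ guessedRow E g R K := by
  set μ := Measure.infinitePi (fun _ : ℕ => ν)
  rw [ae_all_iff]
  intro m
  let A : ℕ → Set (ℕ → α) := fun M => {c | ∀ j < M, c ∉ guessedRow E g (m + K * j) K}
  have hA : ∀ M, DependsOn (fun c => c ∈ A M) (Set.Iio (m + K * M)) := by
    intro M c c' h
    refine propext (forall₂_congr fun j hj => not_congr (iff_of_eq ?_))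
    refine dependsOn_guessedRow (E := E) hg ?_ h
    have := Nat.mul_le_mul_left K (Nat.succ_le_of_lt hj)
    rw [Nat.mul_succ] at this
    omega
  have hmeas : ∀ M, μ (A M) = (1 - p ^ K) ^ M := by
    intro M
    induction M with
    | zero =>
      have : A 0 = Set.univ := by
        ext c
        simp [A]
      rw [this, pow_zero, measure_univ]
    | succ M ih =>
      have h : A (M + 1) = A M \ (A M ∩ guessedRow E g (m + K * M) K) := by
        ext c
        constructor
        · exact fun h => ⟨fun j hj => h j (by omega), fun h' => h M (by omega) h'.2⟩
        · rintro ⟨h1, h2⟩ j hj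
          rcases Nat.lt_succ_iff_lt_or_eq.1 hj with hj | rfl
          · exact h1 j hj
          · exact fun h3 => h2 ⟨h1, h3⟩
      rw [h, measure_sdiff Set.inter_subset_left ?_ (measure_ne_top _ _),
        measure_inter_guessedRow hE hg (hA M), ih, pow_succ,
        ENNReal.mul_sub fun _ _ => ?_, mul_one]
      · exact ih ▸ measure_ne_top μ (A M)
      · refine (measurableSet_of_dependsOn (N := m + K * M + K)
          (DependsOn.inter (fun c c' hc => hA M fun i hi => hc i ?_)
            (dependsOn_guessedRow hg le_rfl))).nullMeasurableSet
        exact (Set.mem_Iio.1 hi).trans_le (Nat.le_add_right _ _)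
  have hlim : Filter.Tendsto (fun M => (1 - p ^ K) ^ M) Filter.atTop (nhds 0) :=
    ENNReal.tendsto_pow_atTop_nhds_zero_of_lt_one
      (ENNReal.sub_lt_self (by simp) one_ne_zero (pow_ne_zero K hp))
  refine measure_mono_null (t := ⋂ M, A M) ?_ (le_antisymm ?_ bot_le)
  · intro c hc
    refine Set.mem_iInter.2 fun M j _ hj => hc ⟨_, Nat.le_add_right m (K * j), hj⟩
  · exact ge_of_tendsto' hlim fun M => (measure_mono (Set.iInter_subset A M)).trans (hmeas M).le

end Guessing

end MahiMahi

theorem mainTheorem4 (f ℓ : ℕ) (hℓ : 1 ≤ ℓ) (hℓn : ℓ ≤ 3 * f + 1) (Tx : Type u)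
    (ν : Measure (MahiMahi.Leaders f ℓ)) [IsProbabilityMeasure ν] (hν : MahiMahi.FairCoin ν)
    (adv : MahiMahi.Adversary f ℓ Tx) :
    ∀ᵐ c ∂(Measure.infinitePi fun _ : ℕ => ν),
      MahiMahi.ReliableLinks 5 adv c → MahiMahi.HonestProgress 5 adv c →
        ∀ i j, MahiMahi.Honest 5 adv c i → MahiMahi.Honest 5 adv c j →
          ∀ b : MahiMahi.Block f Tx,
            MahiMahi.Delivers 5 adv c i b → MahiMahi.Delivers 5 adv c j b := by
  have : DiscreteMeasurableSpace (MahiMahi.Leaders f ℓ) := ⟨fun _ => trivial⟩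
  have hp : ((3 * f + 1 : ℕ) : ENNReal)⁻¹ ≠ 0 := ENNReal.inv_ne_zero.2 (ENNReal.natCast_ne_top _)
  filter_upwards [MahiMahi.ae_exists_guessedRow
    (E := fun v : MahiMahi.Validator f => {L : MahiMahi.Leaders f ℓ | L ⟨0, hℓ⟩ = v})
    (hν ⟨0, hℓ⟩) hp (g := MahiMahi.coreLeader adv)
    (fun _ _ _ h => MahiMahi.coreLeader_congr fun k hk => h k hk) 5]
    with c hc hR hP i j _ hj b hb
  exact hP.delivers hR (i₀ := ⟨0, hℓ⟩) (fun k => Nat.zero_le _) hc hj hb
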